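/- Let $\Bbbk$ be a commutative ring containing $\mathbb{Q}$, and let $\mathfrak{a}=(A,\mathrm{F},d,\star,1)$ be a complete left-unital dg pre-Lie algebra over $\Bbbk$. That is: $A=\{A_n\}_{n\in\mathbb{Z}}$ is a graded $\Bbbk$-module; each $A_n$ has a decreasing filtration by submodules $A_n=\mathrm{F}_0A_n\supset \mathrm{F}_1A_n\supset\cdots$ for which $A_n\to\lim_k A_n/\mathrm{F}_kA_n$ is an isomorphism; $d$ is a filtration preserving square-zero map of degree $-1$; $\star$ is a bilinear product of degree $0$ with $\mathrm{F}_i\star \mathrm{F}_j\subset \mathrm{F}_{i+j}$ whose associator is right symmetric, $$(a\star b)\star c-a\star(b\star c)=(-1)^{|b||c|}\big((a\star c)\star b-a\star(c\star b)\big);$$ $d$ is a derivation of $\star$; and $1\in A_0$ satisfies $d(1)=0$ and $1\star a=a$ for all $a$. Each $A_n$ carries the topology with basis $\{x+\mathrm{F}_kA_n\}$. Let $\mathrm{MC}(\mathfrak{a})=\{\bar\alpha\in A_{-1} : d\bar\alpha+\bar\alpha\star\bar\alpha=0\}$ and $G=1+\mathrm{F}_1A_0$, with the induced topologies. For $\lambda\in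 \mathrm{F}_1A_0$ put $$e^\lambda=1+\sum_{n\ge1}\frac{\lambda^{\star n}}{n!},\quad \lambda^{\star n}=(\cdots(\lambda\star\lambda)\cdots)\star\lambda,\qquad e^{\mathrm{ad}_\lambda}(x)=\sum_{n\geq 0}\frac{1}{n!}\mathrm{ad}_\lambda^n(x),\quad \mathrm{ad}_\lambda(x)=\lambda\star x-x\star\lambda .$$ For $b\in \mathrm{F}_1A_0$ put $a\circledcirc(1+b)=\sum_{n\ge0}\frac1{n!}\{a;b,\dots,b\}$, with $n$ copies of $b$ in the $n$-th term, where the symmetric braces, for $b_1,\dots,b_n$ of degree $0$, are defined by $\{a;\}=a$ and $$\{a;b_1,\dots,b_n\}=\{a;b_1,\dots,b_{n-1}\}\star b_n-\sum_{i=1}^{n-1}\{a;b_1,\dots,b_i\star b_n,\dots,b_{n-1}\}.$$ Let $A\oplus\Bbbk\delta$ be the complete dg pre-Lie algebra (without unit) obtained by adding an element $\delta$ of degree $-1$ and filtration $0$, with $\delta\star\delta=0$, $\delta\star a=0$, $a\star\delta=-(-1)^{|a|}d(a)$ for $a\in A$, and differential $[\delta,-]$, where $[x,y]=x\star y-(-1)^{|x||y|}y\star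 x$; in particular $[\delta,a]=d(a)$. Write $\alpha=\delta+\bar\alpha$ for $\bar\alpha\in \mathrm{MC}(\mathfrak{a})$, and $e^\lambda\star\alpha:=\alpha+(e^\lambda-1)\star\alpha$ (so the unit acts as the identity also on $\delta$). Then: 1. $\lambda\mapsto e^\lambda$ is a bijection $\mathrm{F}_1A_0\to G$, and $\mathfrak{G}=(G,\circledcirc,1)$ is a topological group. 2. There is a jointly continuous left action of the group $\mathfrak{G}$ on the set $\mathrm{MC}(\mathfrak{a})$, $(g,\bar\alpha)\mapsto g\cdot\bar\alpha$, such that for all $\lambda\in \mathrm{F}_1A_0$ and $\bar\alpha\in\mathrm{MC}(\mathfrak{a})$, with $\alpha=\delta+\bar\alpha$ and $e^\lambda\cdot\alpha:=\delta+e^\lambda\cdot\bar\alpha$, the following holds in $A\oplus\Bbbk\delta$: $$e^\lambda\cdot\alpha=e^{\mathrm{ad}_\lambda}(\alpha)=\left(e^\lambda\star\alpha\right)\circledcirc e^{-\lambda}.$$ 3. If the differential is internal, that is, $d=[\delta',-]$ for some $\delta'\in A_{-1}$, then these formulas also hold inside $A$ with $\delta'$ in place of $\delta$ and $\alpha=\delta'+\bar\alpha$.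 -/

import Mathlib

universe u v

/-- A complete differential graded pre-Lie algebra over `k` (no unit), on the graded `k`-module
`(A n)`, `n : ℤ`.  Homological convention: `d` has degree `-1`.  Degrees are tracked by equations,
so `star h a b : A n` for `h : p + q = n`, `a : A p`, `b : A q`. -/
structure CompleteDGPreLie (k : Type u) [CommRing k] (A : ℤ → Type v)
    [∀ n, AddCommGroup (A n)] [∀ n, Module k (A n)] where
  /-- The filtration `F i n = F_i A_n`. -/
  F : ℕ → ∀ n : ℤ, Submodule k (A n)
  F_zero : ∀ n, F 0 n = ⊤
  F_succ_le : ∀ i n, F (i + 1) n ≤ F i n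
  /-- Injectivity of the canonical map `A_n → lim_i A_n / F_i A_n`. -/
  separated : ∀ n (x : A n), (∀ i, x ∈ F i n) → x = 0
  /-- Surjectivity of the canonical map `A_n → lim_i A_n / F_i A_n`. -/
  complete : ∀ n (x : ℕ → A n), (∀ i, x (i + 1) - x i ∈ F i n) → ∃ y, ∀ i, y - x i ∈ F i n
  /-- The differential. -/
  d : ∀ {p q : ℤ}, q + 1 = p → A p →ₗ[k] A q
  d_mem : ∀ {p q : ℤ} (h : q + 1 = p) (i : ℕ) (a : A p), a ∈ F i p → d h a ∈ F i q
  d_d : ∀ {p q r : ℤ} (h : q + 1 = p) (h' : r + 1 = q) (a : A p), d h' (d h a) = 0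
  /-- The pre-Lie product. -/
  star : ∀ {p q n : ℤ}, p + q = n → A p →ₗ[k] A q →ₗ[k] A n
  star_mem : ∀ {p q n : ℤ} (h : p + q = n) (i j : ℕ) (a : A p) (b : A q),
    a ∈ F i p → b ∈ F j q → star h a b ∈ F (i + j) n
  /-- The differential is a derivation. -/
  d_star : ∀ {p q n p' q' n' : ℤ} (h : p + q = n) (hp : p' + 1 = p) (hq : q' + 1 = q)
    (hn : n' + 1 = n) (a : A p) (b : A q),
    d hn (star h a b) = star (show p' + q = n' by omega) (d hp a) b
      + p.negOnePow • star (show p + q' = n' by omega) a (d hq b)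
  /-- The associator is right symmetric. -/
  right_symm : ∀ {p q r pq pr qr n : ℤ} (hpq : p + q = pq) (hpr : p + r = pr) (hqr : q + r = qr)
    (hn : p + q + r = n) (a : A p) (b : A q) (c : A r),
    star (show pq + r = n by omega) (star hpq a b) c
        - star (show p + qr = n by omega) a (star hqr b c)
      = (q * r).negOnePow •
        (star (show pr + q = n by omega) (star hpr a c) b
          - star (show p + qr = n by omega) a (star (show r + q = qr by omega) c b))

/-- A complete left-unital dg pre-Lie algebra. -/
structure CompleteLeftUnitalDGPreLie (k : Type u) [CommRing k] (A : ℤ → Type v)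
    [∀ n, AddCommGroup (A n)] [∀ n, Module k (A n)] extends CompleteDGPreLie k A where
  /-- The left unit; it lies in `F_0 A_0`, which is all of `A_0`. -/
  one : A 0
  d_one : ∀ {q : ℤ} (h : q + 1 = 0), d h one = 0
  one_star : ∀ {p : ℤ} (a : A p), star (zero_add p) one a = a

namespace CompleteDGPreLie

section Basic

variable {k : Type u} [CommRing k] {A : ℤ → Type v}
  [∀ n, AddCommGroup (A n)] [∀ n, Module k (A n)] (𝔭 : CompleteDGPreLie k A)

/-- The topology of `A_n`, with the sets `x + F_i A_n` as a basis. -/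
abbrev topology (n : ℤ) : TopologicalSpace (A n) :=
  TopologicalSpace.generateFrom {S | ∃ (x : A n) (i : ℕ), S = {y | y - x ∈ 𝔭.F i n}}

/-- The series `∑ x_i` in `A_n` converges to `s`. -/
def IsSeriesSum {n : ℤ} (x : ℕ → A n) (s : A n) : Prop :=
  ∀ i, ∃ N, ∀ m ≥ N, (∑ j ∈ Finset.range m, x j) - s ∈ 𝔭.F i n

open Classical in
/-- The sum of a convergent series in `A_n` (and `0` if the series does not converge). -/
noncomputable def seriesSum {n : ℤ} (x : ℕ → A n) : A n :=
  if h : ∃ s, 𝔭.IsSeriesSum x s then h.choose else 0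

/-- The Lie bracket `[a, b] = a ⋆ b - (-1)^{|a||b|} b ⋆ a`. -/
def bracket {p q n : ℤ} (h : p + q = n) (a : A p) (b : A q) : A n :=
  𝔭.star h a b - (p * q).negOnePow • 𝔭.star (show q + p = n by omega) b a

/-- `ad_l`, for `l` of degree `0`. -/
def ad {m : ℤ} (l : A 0) (a : A m) : A m := 𝔭.bracket (zero_add m) l a

/-- Symmetric braces `{a; b_1, …, b_n}`, for `b_1, …, b_n` of degree `0`. -/
def brace {m : ℤ} : (n : ℕ) → A m → (Fin n → A 0) → A m
  | 0, a, _ => a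
  | n + 1, a, b =>
      𝔭.star (add_zero m) (brace n a (Fin.init b)) (b (Fin.last n))
        - ∑ i : Fin n, brace n a (Function.update (Fin.init b) i
            (𝔭.star (add_zero 0) (b i.castSucc) (b (Fin.last n))))

/-- Right-iterated powers: `pow l n` is `l^{⋆ (n+1)} = ((l ⋆ l) ⋆ ⋯) ⋆ l`. -/
def pow (l : A 0) : ℕ → A 0
  | 0 => l
  | n + 1 => 𝔭.star (add_zero 0) (pow l n) l

/-- `(1 + b) ⋆ a = a + b ⋆ a`, where `1` stands for a left unit, possibly a formal one. -/
def oneAddStar {m : ℤ} (b : A 0) (a : A m) : A m := a + 𝔭.star (zero_add m) b a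

variable [Algebra ℚ k]

/-- `e^{ad_l}(a) = ∑ ad_l^n(a) / n!`, for `l` in `F_1 A_0`. -/
noncomputable def expAd {m : ℤ} (l : A 0) (a : A m) : A m :=
  𝔭.seriesSum fun n => algebraMap ℚ k (1 / (n.factorial : ℚ)) • (𝔭.ad l)^[n] a

/-- The circle product `a ⊚ (1 + b) = ∑ {a; b, …, b} / n!`, for `b` in `F_1 A_0`. -/
noncomputable def circOneAdd {m : ℤ} (a : A m) (b : A 0) : A m :=
  𝔭.seriesSum fun n => algebraMap ℚ k (1 / (n.factorial : ℚ)) • 𝔭.brace n a fun _ => b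

/-- `e^l - 1 = ∑_{n ≥ 1} l^{⋆ n} / n!`, for `l` in `F_1 A_0`. -/
noncomputable def expSubOne (l : A 0) : A 0 :=
  𝔭.seriesSum fun n => algebraMap ℚ k (1 / ((n + 1).factorial : ℚ)) • 𝔭.pow l n

end Basic

section Convergence

variable {k : Type u} [CommRing k] {A : ℤ → Type v}
  [∀ n, AddCommGroup (A n)] [∀ n, Module k (A n)] (𝔭 : CompleteDGPreLie k A)

theorem F_antitone (n : ℤ) : Antitone fun i => 𝔭.F i n :=
  antitone_nat_of_succ_le fun i => 𝔭.F_succ_le i n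

theorem IsSeriesSum.unique {n : ℤ} {x : ℕ → A n} {s t : A n}
    (hs : 𝔭.IsSeriesSum x s) (ht : 𝔭.IsSeriesSum x t) : s = t := by
  refine sub_eq_zero.1 (𝔭.separated n _ fun i => ?_)
  obtain ⟨N, hN⟩ := hs i
  obtain ⟨M, hM⟩ := ht i
  have := (𝔭.F i n).sub_mem (hM (max N M) (le_max_right _ _)) (hN (max N M) (le_max_left _ _))
  simpa using this

/-- A series whose `i`-th term lies in `F_i` converges. -/
theorem isSeriesSum_seriesSum {n : ℤ} {x : ℕ → A n} (hx : ∀ i, x i ∈ 𝔭.F i n) :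
    𝔭.IsSeriesSum x (𝔭.seriesSum x) := by
  have hex : ∃ s, 𝔭.IsSeriesSum x s := by
    obtain ⟨y, hy⟩ := 𝔭.complete n (fun i => ∑ j ∈ Finset.range i, x j)
      (fun i => by simpa [Finset.sum_range_succ] using hx i)
    refine ⟨y, fun i => ⟨i, fun m hm => ?_⟩⟩
    have := (𝔭.F i n).neg_mem (𝔭.F_antitone n hm (hy m))
    simpa using this
  rw [seriesSum, dif_pos hex]
  exact hex.choose_spec

theorem brace_mem {m : ℤ} : ∀ (n : ℕ) (j : ℕ) (a : A m) (b : Fin n → A 0) (w : Fin n → ℕ),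
    a ∈ 𝔭.F j m → (∀ i, b i ∈ 𝔭.F (w i) 0) → 𝔭.brace n a b ∈ 𝔭.F (j + ∑ i, w i) m
  | 0, j, a, b, w, ha, _ => by simpa [brace] using ha
  | n + 1, j, a, b, w, ha, hb => by
      rw [brace, Fin.sum_univ_castSucc, ← add_assoc]
      refine Submodule.sub_mem _ (𝔭.star_mem _ _ _ _ _
        (brace_mem n j a _ (fun i => w i.castSucc) ha fun i => hb _) (hb _))
        (Submodule.sum_mem _ fun i _ => ?_)
      have h := brace_mem n j a (Function.update (Fin.init b) i
        (𝔭.star (add_zero 0) (b i.castSucc) (b (Fin.last n))))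
        (Function.update (fun i => w i.castSucc) i (w i.castSucc + w (Fin.last n))) ha
        (fun l => by
          by_cases hl : l = i
          · subst hl
            simpa using 𝔭.star_mem _ _ _ _ _ (hb l.castSucc) (hb (Fin.last n))
          · simpa [Function.update_of_ne hl, Fin.init] using hb l.castSucc)
      have hs : ∑ l, Function.update (fun i : Fin n => w i.castSucc) i
          (w i.castSucc + w (Fin.last n)) l = ∑ l : Fin n, w l.castSucc + w (Fin.last n) := by
        rw [Finset.sum_update_of_mem (Finset.mem_univ i),
          ← Finset.add_sum_erase _ (fun l : Fin n => w l.castSucc) (Finset.mem_univ i),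
          Finset.sdiff_singleton_eq_erase]
        ring
      rwa [hs, ← add_assoc] at h

theorem pow_mem (l : A 0) (hl : l ∈ 𝔭.F 1 0) : ∀ n, 𝔭.pow l n ∈ 𝔭.F (n + 1) 0
  | 0 => by simpa [pow] using hl
  | n + 1 => by
      rw [pow]
      exact 𝔭.star_mem _ _ _ _ _ (pow_mem l hl n) hl

theorem ad_iterate_mem {m : ℤ} (l : A 0) (hl : l ∈ 𝔭.F 1 0) (a : A m) :
    ∀ n, (𝔭.ad l)^[n] a ∈ 𝔭.F n m
  | 0 => by simp [𝔭.F_zero]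
  | n + 1 => by
      rw [Function.iterate_succ_apply']
      have ih := ad_iterate_mem l hl a n
      have h1 := 𝔭.star_mem (zero_add m) _ _ _ _ hl ih
      have h2 := 𝔭.star_mem (add_zero m) _ _ _ _ ih hl
      rw [add_comm] at h1
      simpa [ad, bracket] using Submodule.sub_mem _ h1 h2

variable [Algebra ℚ k]

theorem isSeriesSum_expAd {m : ℤ} (l : A 0) (hl : l ∈ 𝔭.F 1 0) (a : A m) :
    𝔭.IsSeriesSum (fun n => algebraMap ℚ k (1 / (n.factorial : ℚ)) • (𝔭.ad l)^[n] a) (𝔭.expAd l a) :=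
  𝔭.isSeriesSum_seriesSum fun n => Submodule.smul_mem _ _ (𝔭.ad_iterate_mem l hl a n)

theorem isSeriesSum_circOneAdd {m : ℤ} (a : A m) (b : A 0) (hb : b ∈ 𝔭.F 1 0) :
    𝔭.IsSeriesSum (fun n => algebraMap ℚ k (1 / (n.factorial : ℚ)) • 𝔭.brace n a fun _ => b)
      (𝔭.circOneAdd a b) :=
  𝔭.isSeriesSum_seriesSum fun n => Submodule.smul_mem _ _ <| by
    simpa using 𝔭.brace_mem n 0 a (fun _ => b) (fun _ => 1) (by simp [𝔭.F_zero]) fun _ => hb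

theorem isSeriesSum_expSubOne (l : A 0) (hl : l ∈ 𝔭.F 1 0) :
    𝔭.IsSeriesSum (fun n => algebraMap ℚ k (1 / ((n + 1).factorial : ℚ)) • 𝔭.pow l n)
      (𝔭.expSubOne l) :=
  𝔭.isSeriesSum_seriesSum fun n =>
    Submodule.smul_mem _ _ (𝔭.F_succ_le n 0 (𝔭.pow_mem l hl n))

end Convergence

/-! ### The one-dimensional extension making the differential internal -/

section Extension

variable (k : Type u) [CommRing k]

/-- The graded module `k δ`, concentrated in degree `-1`. -/
def Delta (n : ℤ) : Submodule k k := if n = -1 then ⊤ else ⊥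

/-- The graded module `A ⊕ k δ`, with `δ` of degree `-1`. -/
abbrev Ext (A : ℤ → Type v) (n : ℤ) : Type (max u v) := A n × Delta k n

variable {k} {A : ℤ → Type v} [∀ n, AddCommGroup (A n)] [∀ n, Module k (A n)]

/-- The inclusion of `A` in `A ⊕ k δ`. -/
def incl (k : Type u) [CommRing k] {n : ℤ} (a : A n) : Ext k A n := (a, 0)

/-- The element `δ`. -/
def delta (k : Type u) [CommRing k] (A : ℤ → Type v) [∀ n, AddCommGroup (A n)] : Ext k A (-1) :=
  (0, ⟨1, by simp [Delta]⟩)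

theorem Delta_eq_zero {n : ℤ} (h : n ≠ -1) (t : Delta k n) : (t : k) = 0 := by
  have := t.2
  simpa [Delta, h] using this

/-- The product `a ⋆ (t δ) = - (-1)^{|a|} t (d a)` of `a : A p` and `t δ` in degree `q`. -/
def starDelta (𝔭 : CompleteDGPreLie k A) {p q n : ℤ} (h : p + q = n) (a : A p)
    (t : Delta k q) : A n :=
  if hq : q = -1 then -(p.negOnePow • (t : k) • 𝔭.d (show n + 1 = p by omega) a) else 0

theorem starDelta_add (𝔭 : CompleteDGPreLie k A) {p q n : ℤ} (h : p + q = n) (a b : A p)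
    (t : Delta k q) : 𝔭.starDelta h (a + b) t = 𝔭.starDelta h a t + 𝔭.starDelta h b t := by
  by_cases hq : q = -1
  · simp only [starDelta, hq, dif_pos, map_add, smul_add, neg_add]
  · simp [starDelta, hq]

theorem starDelta_starDelta (𝔭 : CompleteDGPreLie k A) {p q r pq n : ℤ} (h : p + q = pq)
    (h' : pq + r = n) (a : A p) (s : Delta k q) (t : Delta k r) :
    𝔭.starDelta h' (𝔭.starDelta h a s) t = 0 := by
  by_cases hq : q = -1 <;> by_cases hr : r = -1 <;>
    simp [starDelta, hq, hr, Units.smul_def, 𝔭.d_d]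

theorem starDelta_star (𝔭 : CompleteDGPreLie k A) {p q r pq pr qr n : ℤ} (hpq : p + q = pq)
    (hpr : p + r = pr) (hqr : q + r = qr) (hn : p + q + r = n) (a : A p) (b : A q)
    (t : Delta k r) :
    𝔭.starDelta (show pq + r = n by omega) (𝔭.star hpq a b) t
        - 𝔭.star (show p + qr = n by omega) a (𝔭.starDelta hqr b t)
      = (q * r).negOnePow • 𝔭.star (show pr + q = n by omega) (𝔭.starDelta hpr a t) b := by
  by_cases hr : r = -1
  · have h0 := 𝔭.d_star hpq (show pr + 1 = p by omega) (show qr + 1 = q by omega)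
      (show n + 1 = pq by omega) a b
    have hs : (q * r).negOnePow = q.negOnePow := by simp [hr]
    have hpq' : pq.negOnePow = p.negOnePow * q.negOnePow := by rw [← hpq, Int.negOnePow_add]
    rw [hs]
    simp only [starDelta, hr, dif_pos, h0, hpq', Units.smul_def, Units.val_mul, map_neg, map_zsmul,
      map_smul, LinearMap.neg_apply, LinearMap.smul_apply, smul_add, smul_neg]
    have hpp : ((p.negOnePow : ℤˣ) : ℤ) * (p.negOnePow : ℤˣ) = 1 := by
      rw [← Units.val_mul, ← sq, Int.units_sq, Units.val_one]
    simp only [smul_comm (t : k) (_ : ℤ), smul_smul]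
    rw [show ((p.negOnePow : ℤˣ) : ℤ) * (q.negOnePow : ℤˣ) * (p.negOnePow : ℤˣ)
      = (q.negOnePow : ℤˣ) by rw [mul_right_comm, hpp, one_mul], mul_comm ((q.negOnePow : ℤˣ) : ℤ)]
    abel
  · simp [starDelta, hr]

/-- The pre-Lie algebra `A ⊕ k δ`: `δ ⋆ δ = 0`, `δ ⋆ a = 0`, `a ⋆ δ = -(-1)^{|a|} d a`, so that
`[δ, a] = d a`.  The differential is `[δ, -]` (hence `d δ = 0`), and `δ` lies in `F_0` and not
in `F_1`. -/
def extension (𝔭 : CompleteDGPreLie k A) : CompleteDGPreLie k (Ext k A) where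
  F i n := (𝔭.F i n).prod (if i = 0 then ⊤ else ⊥)
  F_zero n := by simp [𝔭.F_zero]
  F_succ_le i n := Submodule.prod_mono (𝔭.F_succ_le i n) (by simp)
  separated n x hx := by
    refine Prod.ext (𝔭.separated n _ fun i => (hx i).1) ?_
    have := (hx 1).2
    simpa using this
  complete n x hx := by
    obtain ⟨y, hy⟩ := 𝔭.complete n (fun i => (x i).1) (fun i => (hx i).1)
    refine ⟨(y, (x 1).2), fun i => ⟨hy i, ?_⟩⟩
    cases i with
    | zero => simp
    | succ i =>
      have : ∀ j, (x (j + 1)).2 = (x 1).2 := by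
        intro j
        induction j with
        | zero => rfl
        | succ j ih =>
          have := (hx (j + 1)).2
          simp only [Nat.add_eq_zero_iff, one_ne_zero, and_false, if_false, Prod.snd_sub,
            SetLike.mem_coe, Submodule.mem_bot, sub_eq_zero] at this
          rw [this, ih]
      simp [this i]
  d h := (𝔭.d h).prodMap 0
  d_mem h i a ha := ⟨𝔭.d_mem h i _ ha.1, by simp⟩
  d_d h h' a := by simp [𝔭.d_d]
  star {p q n} h := LinearMap.mk₂ k
    (fun x y => (𝔭.star h x.1 y.1 + 𝔭.starDelta h x.1 y.2, 0))
    (by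
      intro x x' y
      by_cases hq : q = -1 <;> simp [starDelta, hq]
      abel)
    (by
      intro c x y
      by_cases hq : q = -1 <;> simp [starDelta, hq, smul_comm c])
    (by
      intro x y y'
      by_cases hq : q = -1 <;> simp [starDelta, hq, add_smul]
      abel)
    (by
      intro c x y
      by_cases hq : q = -1 <;> simp [starDelta, hq, smul_comm c, mul_smul])
  star_mem {p q n} h i j a b ha hb := by
    refine ⟨Submodule.add_mem _ (𝔭.star_mem h i j _ _ ha.1 hb.1) ?_, by simp⟩
    by_cases hq : q = -1
    · cases j with
      | zero =>
        simp only [starDelta, hq, dif_pos, Units.smul_def]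
        exact Submodule.neg_mem _ (zsmul_mem
          (Submodule.smul_mem _ _ (𝔭.d_mem _ i _ ha.1)) _)
      | succ j =>
        have : b.2 = 0 := by simpa using hb.2
        simp [starDelta, this]
    · simp [starDelta, hq]
  d_star {p q n p' q' n'} h hp hq hn a b := by
    obtain rfl : p = p' + 1 := hp.symm
    refine Prod.ext ?_ (by simp)
    have h0 := 𝔭.d_star h rfl hq hn a.1 b.1
    by_cases hq1 : q = -1
    · simp [starDelta, hq1, h0, Units.smul_def, 𝔭.d_d, Int.negOnePow_succ]
    · simp [starDelta, hq1, h0, Units.smul_def]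
  right_symm {p q r pq pr qr n} hpq hpr hqr hn a b c := by
    refine Prod.ext ?_ (by simp)
    have h0 := 𝔭.right_symm hpq hpr hqr hn a.1 b.1 c.1
    have h1 := 𝔭.starDelta_star hpq hpr hqr hn a.1 b.1 c.2
    have h2 := 𝔭.starDelta_star hpr hpq (show r + q = qr by omega)
      (show p + r + q = n by omega) a.1 c.1 b.2
    have h3 := 𝔭.starDelta_starDelta hpq (show pq + r = n by omega) a.1 b.2 c.2
    have h4 := 𝔭.starDelta_starDelta hpr (show pr + q = n by omega) a.1 c.2 b.2
    have hz : ∀ {p q n : ℤ} (h : p + q = n) (x : A p), 𝔭.starDelta h x 0 = 0 := by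
      intro p q n h x
      simp [starDelta]
    have h5 : (q * r).negOnePow • (r * q).negOnePow
        • 𝔭.star (show pq + r = n by omega) (𝔭.starDelta hpq a.1 b.2) c.1
        = 𝔭.star (show pq + r = n by omega) (𝔭.starDelta hpq a.1 b.2) c.1 := by
      rw [smul_smul, mul_comm r q, ← sq, Int.units_sq, one_smul]
    rw [← h2] at h5
    simp only [LinearMap.mk₂_apply, Prod.fst_sub, Prod.smul_fst, map_add, LinearMap.add_apply,
      starDelta_add, h3, h4, hz, add_zero]
    simp only [smul_sub, smul_add] at h0 h5 ⊢
    rw [sub_eq_iff_eq_add] at h0 h1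
    rw [h0, h1, ← h5]
    abel

theorem extension_bracket_delta (𝔭 : CompleteDGPreLie k A) {p q : ℤ} (h : q + 1 = p)
    (x : Ext k A p) :
    𝔭.extension.bracket (show -1 + p = q by omega) (delta k A) x = 𝔭.extension.d h x := by
  refine Prod.ext ?_ (by simp [bracket, extension])
  by_cases hp : p = -1 <;>
    simp [bracket, extension, delta, starDelta, hp, smul_smul, ← sq, Int.units_sq]

end Extension

end CompleteDGPreLie

namespace CompleteLeftUnitalDGPreLie

variable {k : Type u} [CommRing k] {A : ℤ → Type v}
  [∀ n, AddCommGroup (A n)] [∀ n, Module k (A n)] (𝔞 : CompleteLeftUnitalDGPreLie k A)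

/-- The set `1 + F_1 A_0` of group-like elements. -/
def GroupLike : Type v := {g : A 0 // g - 𝔞.one ∈ 𝔞.F 1 0}

/-- The set of Maurer–Cartan elements of `𝔞`. -/
def MC : Type v :=
  {a : A (-1) // 𝔞.d (show (-2 : ℤ) + 1 = -1 by norm_num) a
    + 𝔞.star (show (-1 : ℤ) + -1 = -2 by norm_num) a a = 0}

/-- The sets `g + F_i A_0` form a basis of this topology. -/
instance : TopologicalSpace 𝔞.GroupLike := (𝔞.topology 0).induced Subtype.val

instance : TopologicalSpace 𝔞.MC := (𝔞.topology (-1)).induced Subtype.val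

variable [Algebra ℚ k]

/-- The pre-Lie exponential `e^l = 1 + l + l^{⋆ 2} / 2! + ⋯`, for `l` in `F_1 A_0`. -/
noncomputable def exp (l : A 0) : A 0 := 𝔞.one + 𝔞.expSubOne l

/-- The circle product `a ⊚ g`, for `g` in `1 + F_1 A_0`. -/
noncomputable def circ {m : ℤ} (a : A m) (g : A 0) : A m := 𝔞.circOneAdd a (g - 𝔞.one)

end CompleteLeftUnitalDGPreLie

-- Everything is governed by right multiplication `R_l : x ↦ x ⋆ l` with `l` in `F_1 A_0`. It raises
-- the filtration, so `e^{R_l}` converges and is invertible with inverse `e^{-R_l}`. Right symmetry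
-- of the associator says exactly that `R_l (x ⋆ y) = R_l x ⋆ y - x ⋆ ad_l y`. Exponentiating with
-- the binomial theorem gives `e^{R_l} (x ⋆ y) = e^{R_l} x ⋆ e^{-ad_l} y` (`expOp_rightMul_star`).
-- The same computation with a formal left unit in place of `x` gives `e^{R_l} (e^{ad_l} y) = e^l ⋆
-- y` (`expOp_rightMul_expAd`).
--
-- The second ingredient links these exponentials to the circle product: `a ⊚ (e^{R_l} (1 + b)) =
-- e^{R_l} (a ⊚ (1 + b))` (`circOneAdd_expSubOne_add`). With `t R_l` in place of `R_l`, both sides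
-- solve the differential equation `P' = P ⋆ l` with the same initial value. For the left side this
-- follows from the symmetry of the braces, the Leibniz rule and a telescoping sum
-- (`derivation_circOneAdd`). The argument runs in an auxiliary pre-Lie algebra of exponential power
-- series in `t`, and evaluation at `t = 1` is a morphism back to `A`.
--
-- Taking `b = 0` gives `a ⊚ e^l = e^{R_l} a`. Hence `(e^l ⋆ x) ⊚ e^{-l} = e^{-R_l} e^{R_l} e^{ad_l}
-- x = e^{ad_l} x`, the circle product is associative, and `e^{-l}` is inverse to `e^l`. That
-- `e^{ad}` turns the circle product into composition (`expAd_expAd`), and that it preserves `α ⋆ α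
-- = 0` (`expAd_star_expAd`), is checked after applying an injective `e^{R}`; the
-- Baker–Campbell–Hausdorff formula is not needed.
--
-- Bijectivity of the exponential is a contraction argument: `e^l - 1 - l` gains one filtration
-- step. Continuity holds because all operations respect congruence modulo each `F_i`. The action
-- comes from applying these facts in `A ⊕ k δ`, where the Maurer–Cartan equation becomes `α ⋆ α =
-- 0`. For an internal differential, a linear map replacing `δ` by the given element carries the
-- adjoint formula into `A`.

universe w

namespace CompleteDGPreLie

/-- The scalar `1 / n!`. -/
noncomputable def invFact (k : Type u) [CommRing k] [Algebra ℚ k] (n : ℕ) : k :=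
  algebraMap ℚ k (1 / (n.factorial : ℚ))

/-! ### Factorial scalars -/

section InvFact

variable (k : Type u) [CommRing k] [Algebra ℚ k]

@[simp] theorem invFact_zero : invFact k 0 = 1 := by simp [invFact]

theorem invFact_succ_mul (n : ℕ) : invFact k (n + 1) * ((n + 1 : ℕ) : k) = invFact k n := by
  rw [invFact, invFact, ← map_natCast (algebraMap ℚ k), ← map_mul]
  congr 1
  have := Nat.factorial_ne_zero n
  rw [Nat.factorial_succ]
  push_cast
  field_simp

theorem invFact_mul_choose {n i j : ℕ} (h : i + j = n) :
    invFact k n * (n.choose i : k) = invFact k i * invFact k j := by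
  subst h
  rw [invFact, invFact, invFact, ← map_natCast (algebraMap ℚ k), ← map_mul, ← map_mul]
  congr 1
  rw [Nat.cast_add_choose]
  have := Nat.factorial_ne_zero i
  have := Nat.factorial_ne_zero j
  have := Nat.factorial_ne_zero (i + j)
  field_simp

/-- Since `2` is invertible. This is what turns the sign in right symmetry for odd elements into a
vanishing statement. -/
theorem eq_zero_of_eq_neg {M : Type*} [AddCommGroup M] [Module k M] {x : M} (h : x = -x) :
    x = 0 := by
  have h2 : (2 : k) • x = 0 := by rw [two_smul]; nth_rw 1 [h]; simp
  have h3 : algebraMap ℚ k (1 / 2) * 2 = 1 := by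
    rw [← map_ofNat (algebraMap ℚ k) 2, ← map_mul]
    norm_num
  rw [← one_smul k x, ← h3, mul_smul, h2, smul_zero]

end InvFact

/-! ### Convergent series in complete filtered modules -/

section Series

variable {k : Type u} [CommRing k] {A : ℤ → Type v}
  [∀ n, AddCommGroup (A n)] [∀ n, Module k (A n)] {𝔭 : CompleteDGPreLie k A}
  {B : ℤ → Type w} [∀ n, AddCommGroup (B n)] [∀ n, Module k (B n)] {𝔮 : CompleteDGPreLie k B}

theorem eq_of_forall_sub_mem {n : ℤ} {x y : A n} (h : ∀ i, x - y ∈ 𝔭.F i n) : x = y :=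
  sub_eq_zero.1 (𝔭.separated n _ h)

theorem sub_mem_trans {n : ℤ} {i : ℕ} {x y z : A n} (h : x - y ∈ 𝔭.F i n)
    (h' : y - z ∈ 𝔭.F i n) : x - z ∈ 𝔭.F i n := by
  simpa using add_mem h h'

theorem sub_mem_symm {n : ℤ} {i : ℕ} {x y : A n} (h : x - y ∈ 𝔭.F i n) :
    y - x ∈ 𝔭.F i n := by
  simpa using neg_mem h

theorem F_le {i j : ℕ} (h : i ≤ j) {n : ℤ} {x : A n} (hx : x ∈ 𝔭.F j n) : x ∈ 𝔭.F i n :=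
  𝔭.F_antitone n h hx

theorem mem_F_zero {n : ℤ} (x : A n) : x ∈ 𝔭.F 0 n := by simp [𝔭.F_zero]

theorem IsSeriesSum.seriesSum_eq {n : ℤ} {x : ℕ → A n} {s : A n} (h : 𝔭.IsSeriesSum x s) :
    𝔭.seriesSum x = s := by
  have hex : ∃ s, 𝔭.IsSeriesSum x s := ⟨s, h⟩
  rw [seriesSum, dif_pos hex]
  exact IsSeriesSum.unique 𝔭 hex.choose_spec h

theorem IsSeriesSum.map {m n : ℤ} (f : A m →ₗ[k] B n)
    (hf : ∀ i a, a ∈ 𝔭.F i m → f a ∈ 𝔮.F i n) {x : ℕ → A m} {s : A m}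
    (h : 𝔭.IsSeriesSum x s) : 𝔮.IsSeriesSum (fun j => f (x j)) (f s) := by
  intro i
  obtain ⟨N, hN⟩ := h i
  exact ⟨N, fun M hM => by simpa using hf i _ (hN M hM)⟩

theorem IsSeriesSum.sub {n : ℤ} {x y : ℕ → A n} {s t : A n} (hx : 𝔭.IsSeriesSum x s)
    (hy : 𝔭.IsSeriesSum y t) : 𝔭.IsSeriesSum (fun j => x j - y j) (s - t) := by
  intro i
  obtain ⟨N, hN⟩ := hx i
  obtain ⟨M, hM⟩ := hy i
  refine ⟨max N M, fun m hm => ?_⟩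
  have := sub_mem (hN m (le_trans (le_max_left _ _) hm)) (hM m (le_trans (le_max_right _ _) hm))
  rw [Finset.sum_sub_distrib]
  convert this using 1
  abel

theorem IsSeriesSum.add {n : ℤ} {x y : ℕ → A n} {s t : A n} (hx : 𝔭.IsSeriesSum x s)
    (hy : 𝔭.IsSeriesSum y t) : 𝔭.IsSeriesSum (fun j => x j + y j) (s + t) := by
  intro i
  obtain ⟨N, hN⟩ := hx i
  obtain ⟨M, hM⟩ := hy i
  refine ⟨max N M, fun m hm => ?_⟩
  have := add_mem (hN m (le_trans (le_max_left _ _) hm)) (hM m (le_trans (le_max_right _ _) hm))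
  rw [Finset.sum_add_distrib]
  convert this using 1
  abel

theorem IsSeriesSum.smul {n : ℤ} (c : k) {x : ℕ → A n} {s : A n} (h : 𝔭.IsSeriesSum x s) :
    𝔭.IsSeriesSum (fun j => c • x j) (c • s) :=
  h.map (LinearMap.lsmul k (A n) c) fun _ _ ha => Submodule.smul_mem _ _ ha

theorem IsSeriesSum.cons {n : ℤ} {x : ℕ → A n} {s : A n}
    (h : 𝔭.IsSeriesSum (fun j => x (j + 1)) s) : 𝔭.IsSeriesSum x (x 0 + s) := by
  intro i
  obtain ⟨N, hN⟩ := h i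
  refine ⟨N + 1, fun m hm => ?_⟩
  obtain ⟨m, rfl⟩ : ∃ m', m = m' + 1 := ⟨m - 1, by omega⟩
  have := hN m (by omega)
  rw [Finset.sum_range_succ']
  convert this using 1
  abel

/-- A series whose terms past `N` lie in `F_i` is congruent to its `N`-th partial sum. -/
theorem IsSeriesSum.partial_sub_mem {n : ℤ} {x : ℕ → A n} {s : A n} (h : 𝔭.IsSeriesSum x s)
    (N i : ℕ) (hx : ∀ j, N ≤ j → x j ∈ 𝔭.F i n) :
    (∑ j ∈ Finset.range N, x j) - s ∈ 𝔭.F i n := by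
  obtain ⟨M, hM⟩ := h i
  refine sub_mem_trans ?_ (hM (max N M) (le_max_right _ _))
  refine sub_mem_symm ?_
  rw [← Finset.sum_Ico_eq_sub _ (le_max_left N M)]
  exact Submodule.sum_mem _ fun j hj => hx j (Finset.mem_Ico.1 hj).1

theorem IsSeriesSum.mem {n : ℤ} {x : ℕ → A n} {s : A n} (h : 𝔭.IsSeriesSum x s)
    (i : ℕ) (hx : ∀ j, x j ∈ 𝔭.F i n) : s ∈ 𝔭.F i n := by
  simpa using neg_mem (h.partial_sub_mem 0 i fun j _ => hx j)

theorem IsSeriesSum.of_eq_zero {n : ℤ} {x : ℕ → A n} (h : ∀ j, x (j + 1) = 0) :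
    𝔭.IsSeriesSum x (x 0) := by
  intro i
  refine ⟨1, fun m hm => ?_⟩
  obtain ⟨m, rfl⟩ : ∃ m', m = m' + 1 := ⟨m - 1, by omega⟩
  simp [Finset.sum_range_succ', h]

/-- The Cauchy rearrangement of a double series. -/
theorem IsSeriesSum.antidiagonal {n : ℤ} {C : ℕ → ℕ → A n} {r : ℕ → A n} {s : A n}
    (hC : ∀ i j, C i j ∈ 𝔭.F (i + j) n) (hr : ∀ i, 𝔭.IsSeriesSum (C i) (r i))
    (hs : 𝔭.IsSeriesSum r s) :
    𝔭.IsSeriesSum (fun N => ∑ p ∈ Finset.HasAntidiagonal.antidiagonal N, C p.1 p.2) s := by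
  intro i
  refine ⟨i, fun m hm => F_le hm ?_⟩
  have hra : ∀ a, r a ∈ 𝔭.F a n := fun a => (hr a).mem a fun j => F_le (by omega) (hC a j)
  refine sub_mem_trans ?_ (hs.partial_sub_mem m m fun j hj => F_le hj (hra j))
  -- The triangle `i + j < m` is cut into rows. Row `a` stops at `j = m - a`, and what it misses of
  -- `r a` lies in `F_m`.
  simp_rw [Finset.Nat.sum_antidiagonal_eq_sum_range_succ C]
  rw [Finset.sum_range_diag_flip, ← Finset.sum_sub_distrib]
  refine Submodule.sum_mem _ fun a ha => ?_
  refine (hr a).partial_sub_mem _ _ fun j hj => F_le ?_ (hC a j)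
  omega

end Series

/-- Pascal's rule: each of the `n` steps shifts either the first index or the second. -/
theorem binomial_recursion {M : Type*} [AddCommMonoid M] (C : ℕ → ℕ → ℕ → M)
    (hC : ∀ n i j, C (n + 1) i j = C n (i + 1) j + C n i (j + 1)) (n : ℕ) : ∀ i j,
    C n i j = ∑ p ∈ Finset.HasAntidiagonal.antidiagonal n, n.choose p.1 • C 0 (i + p.1) (j + p.2) := by
  induction n with
  | zero => simp
  | succ n ih =>
    intro i j
    rw [hC, ih, ih, Finset.sum_antidiagonal_choose_succ_nsmul
      (fun a b => C 0 (i + a) (j + b)) n, add_comm]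
    congr 1
    · refine Finset.sum_congr rfl fun p _ => ?_
      rw [add_assoc j, add_comm 1]
    · refine Finset.sum_congr rfl fun p hp => ?_
      rw [Nat.choose_symm_of_eq_add (Finset.HasAntidiagonal.mem_antidiagonal.1 hp).symm, add_assoc i,
        add_comm 1]

/-! ### Exponentials of filtration-raising endomorphisms -/

section ExpOp

variable {k : Type u} [CommRing k] {A : ℤ → Type v}
  [∀ n, AddCommGroup (A n)] [∀ n, Module k (A n)] (𝔭 : CompleteDGPreLie k A)

/-- A linear endomorphism of `A_m` which raises the filtration by one. -/
def Raises {m : ℤ} (f : A m →ₗ[k] A m) : Prop := ∀ i a, a ∈ 𝔭.F i m → f a ∈ 𝔭.F (i + 1) m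

variable {𝔭}

theorem Raises.iterate_mem {m : ℤ} {f : A m →ₗ[k] A m} (hf : 𝔭.Raises f) {i : ℕ} {x : A m}
    (hx : x ∈ 𝔭.F i m) (n : ℕ) : f^[n] x ∈ 𝔭.F (i + n) m := by
  induction n with
  | zero => simpa using hx
  | succ n ih => rw [Function.iterate_succ_apply']; exact hf _ _ ih

theorem Raises.neg {m : ℤ} {f : A m →ₗ[k] A m} (hf : 𝔭.Raises f) : 𝔭.Raises (-f) :=
  fun i a ha => by simpa using hf i a ha

theorem Raises.add {m : ℤ} {f g : A m →ₗ[k] A m} (hf : 𝔭.Raises f) (hg : 𝔭.Raises g) :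
    𝔭.Raises (f + g) := fun i a ha => add_mem (hf i a ha) (hg i a ha)

variable [Algebra ℚ k]

variable (𝔭) in
/-- The exponential `∑ f^n / n!` of an endomorphism `f` of `A_m`. -/
noncomputable def expOp {m : ℤ} (f : A m →ₗ[k] A m) (x : A m) : A m :=
  𝔭.seriesSum fun n => invFact k n • f^[n] x

theorem Raises.isSeriesSum_expOp {m : ℤ} {f : A m →ₗ[k] A m} (hf : 𝔭.Raises f) (x : A m) :
    𝔭.IsSeriesSum (fun n => invFact k n • f^[n] x) (𝔭.expOp f x) :=
  𝔭.isSeriesSum_seriesSum fun i => Submodule.smul_mem _ _ <| by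
    simpa using hf.iterate_mem (mem_F_zero x) i

theorem Raises.expOp_mem {m : ℤ} {f : A m →ₗ[k] A m} (hf : 𝔭.Raises f) {i : ℕ} {x : A m}
    (hx : x ∈ 𝔭.F i m) : 𝔭.expOp f x ∈ 𝔭.F i m :=
  (hf.isSeriesSum_expOp x).mem i fun j =>
    Submodule.smul_mem _ _ (F_le (Nat.le_add_right _ _) (hf.iterate_mem hx j))

theorem expOp_zero_left {m : ℤ} (x : A m) : 𝔭.expOp (0 : A m →ₗ[k] A m) x = x := by
  have := IsSeriesSum.of_eq_zero (𝔭 := 𝔭)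
    (x := fun n => invFact k n • (0 : A m →ₗ[k] A m)^[n] x)
    (fun j => by simp [Function.iterate_succ_apply'])
  simpa [expOp] using this.seriesSum_eq

theorem expOp_zero_right {m : ℤ} (f : A m →ₗ[k] A m) : 𝔭.expOp f 0 = 0 := by
  have h0 : ∀ n, f^[n] 0 = 0 := fun n => by induction n <;> simp_all
  have := IsSeriesSum.of_eq_zero (𝔭 := 𝔭) (x := fun n => invFact k n • f^[n] 0)
    (fun j => by simp [h0])
  simpa [expOp] using this.seriesSum_eq

/-- The binomial theorem for exponentials, applied to a double family on which `h` acts as the sum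
of the two shifts. -/
theorem expOp_eq_of_double {m : ℤ} (h : A m →ₗ[k] A m) {C : ℕ → ℕ → A m} {r : ℕ → A m} {s : A m}
    (hC : ∀ i j, C i j ∈ 𝔭.F (i + j) m) (hh : ∀ i j, h (C i j) = C (i + 1) j + C i (j + 1))
    (hr : ∀ i, 𝔭.IsSeriesSum (fun j => invFact k j • C i j) (r i))
    (hs : 𝔭.IsSeriesSum (fun i => invFact k i • r i) s) : 𝔭.expOp h (C 0 0) = s := by
  have key := IsSeriesSum.antidiagonal (𝔭 := 𝔭)
    (C := fun i j => invFact k i • invFact k j • C i j)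
    (fun i j => Submodule.smul_mem _ _ (Submodule.smul_mem _ _ (hC i j)))
    (fun i => (hr i).smul (invFact k i)) hs
  refine IsSeriesSum.seriesSum_eq ?_
  convert key using 2 with N
  rw [binomial_recursion (fun n i j => h^[n] (C i j)) _ N 0 0, Finset.smul_sum]
  · refine Finset.sum_congr rfl fun p hp => ?_
    simp only [Function.iterate_zero, id, zero_add]
    rw [← Nat.cast_smul_eq_nsmul k, smul_smul, smul_smul,
      invFact_mul_choose k (Finset.HasAntidiagonal.mem_antidiagonal.1 hp)]
  · intro n i j
    rw [Function.iterate_succ_apply, hh, iterate_map_add]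

theorem Raises.expOp_expOp {m : ℤ} {f g : A m →ₗ[k] A m} (hf : 𝔭.Raises f) (hg : 𝔭.Raises g)
    (hfg : ∀ x, f (g x) = g (f x)) (x : A m) :
    𝔭.expOp f (𝔭.expOp g x) = 𝔭.expOp (f + g) x := by
  symm
  have hpow : ∀ i, (⇑f)^[i] = ⇑(f ^ i) := fun i => by rw [Module.End.coe_pow]
  -- Commutation is what makes `f + g` act on this double family as the sum of the two shifts.
  refine expOp_eq_of_double (f + g) (C := fun i j => f^[i] (g^[j] x))
    (r := fun i => f^[i] (𝔭.expOp g x)) (fun i j => ?_) (fun i j => ?_) (fun i => ?_)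
    (hf.isSeriesSum_expOp _)
  · rw [add_comm]
    exact hf.iterate_mem (by simpa using hg.iterate_mem (mem_F_zero x) j) i
  · have hc : Function.Commute (⇑g) (⇑f)^[i] :=
      Function.Commute.iterate_right (fun x => (hfg x).symm) i
    rw [LinearMap.add_apply, Function.iterate_succ_apply', Function.iterate_succ_apply',
      hc.eq]
  · have := (hg.isSeriesSum_expOp x).map (𝔮 := 𝔭) (f ^ i) fun a y hy => by
      rw [← hpow]
      exact F_le (Nat.le_add_right _ _) (hf.iterate_mem hy i)
    simpa [hpow] using this

theorem Raises.expOp_neg_expOp {m : ℤ} {f : A m →ₗ[k] A m} (hf : 𝔭.Raises f) (x : A m) :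
    𝔭.expOp (-f) (𝔭.expOp f x) = x := by
  rw [hf.neg.expOp_expOp hf (by simp), neg_add_cancel, expOp_zero_left]

theorem Raises.expOp_expOp_neg {m : ℤ} {f : A m →ₗ[k] A m} (hf : 𝔭.Raises f) (x : A m) :
    𝔭.expOp f (𝔭.expOp (-f) x) = x := by
  rw [hf.expOp_expOp hf.neg (by simp), add_neg_cancel, expOp_zero_left]

end ExpOp

/-! ### Right multiplication and the adjoint action -/

section RightMul

variable {k : Type u} [CommRing k] {A : ℤ → Type v}
  [∀ n, AddCommGroup (A n)] [∀ n, Module k (A n)] (𝔭 : CompleteDGPreLie k A)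

/-- Right multiplication by an element of degree `0`. -/
def rightMul (m : ℤ) (l : A 0) : A m →ₗ[k] A m := (𝔭.star (add_zero m)).flip l

@[simp] theorem rightMul_apply {m : ℤ} (l : A 0) (x : A m) :
    𝔭.rightMul m l x = 𝔭.star (add_zero m) x l := rfl

theorem ad_eq {m : ℤ} (l : A 0) (x : A m) :
    𝔭.ad l x = 𝔭.star (zero_add m) l x - 𝔭.star (add_zero m) x l := by
  simp [ad, bracket]

/-- The adjoint action, as a linear map. -/
def adHom (m : ℤ) (l : A 0) : A m →ₗ[k] A m := 𝔭.star (zero_add m) l - 𝔭.rightMul m l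

theorem adHom_apply {m : ℤ} (l : A 0) (x : A m) :
    𝔭.adHom m l x = 𝔭.star (zero_add m) l x - 𝔭.star (add_zero m) x l := rfl

theorem coe_adHom {m : ℤ} (l : A 0) : ⇑(𝔭.adHom m l) = 𝔭.ad l :=
  funext fun x => (𝔭.ad_eq l x).symm

theorem rightMul_neg (m : ℤ) (l : A 0) : 𝔭.rightMul m (-l) = -𝔭.rightMul m l := by
  ext; simp

variable {𝔭}

theorem raises_rightMul (m : ℤ) {l : A 0} (hl : l ∈ 𝔭.F 1 0) : 𝔭.Raises (𝔭.rightMul m l) :=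
  fun i _ ha => 𝔭.star_mem (add_zero m) i 1 _ _ ha hl

theorem raises_adHom (m : ℤ) {l : A 0} (hl : l ∈ 𝔭.F 1 0) : 𝔭.Raises (𝔭.adHom m l) :=
  fun i a ha => sub_mem (by rw [add_comm]; exact 𝔭.star_mem (zero_add m) 1 i _ _ hl ha)
    (raises_rightMul m hl i a ha)

/-- `R_l` is a derivation relative to `- ad_l` on the right factor. -/
theorem rightMul_star {p q n : ℤ} (h : p + q = n) (x : A p) (y : A q) (l : A 0) :
    𝔭.rightMul n l (𝔭.star h x y)
      = 𝔭.star h (𝔭.rightMul p l x) y + 𝔭.star h x ((-𝔭.adHom q l) y) := by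
  have := 𝔭.right_symm h (add_zero p) (add_zero q) (show p + q + 0 = n by omega) x y l
  simp only [mul_zero, Int.negOnePow_zero, one_smul] at this
  rw [sub_eq_iff_eq_add] at this
  simp only [rightMul_apply, this, LinearMap.neg_apply, adHom_apply, map_neg, map_sub]
  abel

theorem pow_sub_mem {l l' : A 0} (hl : l ∈ 𝔭.F 1 0) (hl' : l' ∈ 𝔭.F 1 0) {i : ℕ}
    (h : l - l' ∈ 𝔭.F i 0) (n : ℕ) : 𝔭.pow l n - 𝔭.pow l' n ∈ 𝔭.F (i + n) 0 := by
  induction n with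
  | zero => simpa [pow] using h
  | succ n ih =>
    have h1 := 𝔭.star_mem (add_zero 0) _ _ _ _ ih hl
    have h2 := 𝔭.star_mem (add_zero 0) _ _ _ _ (𝔭.pow_mem l' hl' n) h
    simp only [map_sub, LinearMap.sub_apply] at h1 h2
    exact sub_mem_trans (F_le (by omega) h1) (F_le (by omega) h2)

variable [Algebra ℚ k]

theorem expAd_eq {m : ℤ} (l : A 0) (x : A m) : 𝔭.expAd l x = 𝔭.expOp (𝔭.adHom m l) x := by
  rw [expOp, coe_adHom]; rfl

/-- Exponentiates the twisted Leibniz rule: on the family `R_l^i x ⋆ (-ad_l)^j y`, the operator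
`R_l` is the sum of the two shifts. -/
theorem expOp_rightMul_star {p q n : ℤ} (h : p + q = n) (x : A p) (y : A q) {l : A 0}
    (hl : l ∈ 𝔭.F 1 0) : 𝔭.expOp (𝔭.rightMul n l) (𝔭.star h x y)
      = 𝔭.star h (𝔭.expOp (𝔭.rightMul p l) x) (𝔭.expOp (-𝔭.adHom q l) y) := by
  have hR := raises_rightMul p hl
  have hS := (raises_adHom q hl).neg
  refine expOp_eq_of_double _
    (C := fun i j => 𝔭.star h ((𝔭.rightMul p l)^[i] x) ((-𝔭.adHom q l)^[j] y))
    (r := fun i => 𝔭.star h ((𝔭.rightMul p l)^[i] x) (𝔭.expOp (-𝔭.adHom q l) y))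
    (fun i j => ?_) (fun i j => ?_) (fun i => ?_) ?_
  · exact 𝔭.star_mem h _ _ _ _ (by simpa using hR.iterate_mem (mem_F_zero x) i)
      (by simpa using hS.iterate_mem (mem_F_zero y) j)
  · rw [rightMul_star, Function.iterate_succ_apply', Function.iterate_succ_apply']
  · simpa using (hS.isSeriesSum_expOp y).map (𝔮 := 𝔭) (𝔭.star h ((𝔭.rightMul p l)^[i] x))
      fun a z hz => by simpa using 𝔭.star_mem h 0 a _ _ (mem_F_zero _) hz
  · simpa using (hR.isSeriesSum_expOp x).map (𝔮 := 𝔭)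
      ((𝔭.star h).flip (𝔭.expOp (-𝔭.adHom q l) y))
      fun a z hz => by simpa using 𝔭.star_mem h a 0 _ _ hz (mem_F_zero _)

/-- This is the exponentiated Leibniz rule for the product of a formal left unit with `y`. Since no
unit is available, row `0` of the double family is entered by hand, and row `i + 1` uses `l^{⋆
(i+1)}`, which stands for `R_l^{i+1} 1`. -/
theorem expOp_rightMul_eq {m : ℤ} (y : A m) {l : A 0} (hl : l ∈ 𝔭.F 1 0) :
    𝔭.expOp (𝔭.rightMul m l) y
      = 𝔭.oneAddStar (𝔭.expSubOne l) (𝔭.expOp (-𝔭.adHom m l) y) := by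
  have hS := (raises_adHom m hl).neg
  set C : ℕ → ℕ → A m := fun i j => Nat.casesOn i ((-𝔭.adHom m l)^[j] y)
    fun i => 𝔭.star (zero_add m) (𝔭.pow l i) ((-𝔭.adHom m l)^[j] y) with hCdef
  refine expOp_eq_of_double (𝔭.rightMul m l) (C := C)
    (r := fun i => Nat.casesOn i (𝔭.expOp (-𝔭.adHom m l) y)
      fun i => 𝔭.star (zero_add m) (𝔭.pow l i) (𝔭.expOp (-𝔭.adHom m l) y))
    (fun i j => ?_) (fun i j => ?_) (fun i => ?_) ?_
  · have hj : (-𝔭.adHom m l)^[j] y ∈ 𝔭.F j m := by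
      simpa using hS.iterate_mem (mem_F_zero y) j
    cases i with
    | zero => simpa [hCdef] using hj
    | succ i => exact 𝔭.star_mem _ _ _ _ _ (𝔭.pow_mem l hl i) hj
  · cases i with
    | zero =>
      have h1 : C 0 (j + 1) = (-𝔭.adHom m l) (C 0 j) := Function.iterate_succ_apply' _ _ _
      have h2 : C 1 j = 𝔭.star (zero_add m) l (C 0 j) := rfl
      rw [zero_add, h1, h2, LinearMap.neg_apply, adHom_apply, rightMul_apply]
      abel
    | succ i =>
      simp only [hCdef, Function.iterate_succ_apply', pow, rightMul_star]
      simp only [rightMul_apply]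
  · cases i with
    | zero => exact hS.isSeriesSum_expOp y
    | succ i =>
      simpa [hCdef] using (hS.isSeriesSum_expOp y).map (𝔮 := 𝔭)
        (𝔭.star (zero_add m) (𝔭.pow l i))
        fun a z hz => by simpa using 𝔭.star_mem (zero_add m) 0 a _ _ (mem_F_zero _) hz
  · have := (𝔭.isSeriesSum_expSubOne l hl).map (𝔮 := 𝔭)
      ((𝔭.star (zero_add m)).flip (𝔭.expOp (-𝔭.adHom m l) y))
      fun a z hz => by simpa using 𝔭.star_mem (zero_add m) a 0 _ _ hz (mem_F_zero _)
    have := IsSeriesSum.cons (𝔭 := 𝔭) (x := fun i => invFact k i • (Nat.casesOn i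
      (𝔭.expOp (-𝔭.adHom m l) y)
      fun i => 𝔭.star (zero_add m) (𝔭.pow l i) (𝔭.expOp (-𝔭.adHom m l) y) : A m))
      (by simpa [invFact] using this)
    simpa [oneAddStar] using this

/-- `e^{R_l} (e^{ad_l} x) = e^l ⋆ x`. -/
theorem expOp_rightMul_expAd {m : ℤ} (x : A m) {l : A 0} (hl : l ∈ 𝔭.F 1 0) :
    𝔭.expOp (𝔭.rightMul m l) (𝔭.expAd l x) = 𝔭.oneAddStar (𝔭.expSubOne l) x := by
  rw [expOp_rightMul_eq _ hl, expAd_eq, (raises_adHom m hl).expOp_neg_expOp]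

end RightMul

/-! ### Operators acting on one slot at a time -/

section SlotSum

variable {X M : Type*} [AddCommGroup M] {n : ℕ}

/-- The sum over all slots `i` of the value of `f` with `φ` applied in slot `i`. -/
def slotSum (φ : X → X) (f : (Fin n → X) → M) (b : Fin n → X) : M :=
  ∑ i, f (Function.update b i (φ (b i)))

theorem slotSum_slotSum (φ ψ : X → X) (f : (Fin n → X) → M) (b : Fin n → X) :
    slotSum φ (slotSum ψ f) b = slotSum (fun x => ψ (φ x)) f b
      + ∑ i, ∑ j, if i = j then 0 else
          f (Function.update (Function.update b i (φ (b i))) j (ψ (b j))) := by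
  simp only [slotSum]
  rw [← Finset.sum_add_distrib]
  refine Finset.sum_congr rfl fun i _ => ?_
  rw [← Finset.add_sum_erase _ _ (Finset.mem_univ i),
    ← Finset.add_sum_erase (a := i) _ _ (Finset.mem_univ i)]
  simp only [Function.update_self, Function.update_idem, if_true, zero_add]
  congr 1
  refine Finset.sum_congr rfl fun j hj => ?_
  have hj' := Finset.ne_of_mem_erase hj
  rw [if_neg hj'.symm, Function.update_of_ne hj']

/-- The terms with `φ` and `ψ` in distinct slots are symmetric, so only the diagonal terms, where
both hit the same slot, obstruct commutation. -/
theorem slotSum_comm (φ ψ : X → X) (f : (Fin n → X) → M) (b : Fin n → X) :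
    slotSum φ (slotSum ψ f) b + slotSum (fun x => φ (ψ x)) f b
      = slotSum ψ (slotSum φ f) b + slotSum (fun x => ψ (φ x)) f b := by
  rw [slotSum_slotSum, slotSum_slotSum, Finset.sum_comm]
  have : (∑ j, ∑ i, if i = j then 0 else
      f (Function.update (Function.update b i (φ (b i))) j (ψ (b j))))
      = ∑ i, ∑ j, if i = j then 0 else
      f (Function.update (Function.update b i (ψ (b i))) j (φ (b j))) := by
    refine Finset.sum_congr rfl fun i _ => Finset.sum_congr rfl fun j _ => ?_
    by_cases h : j = i
    · simp [h]
    · rw [if_neg h, if_neg (Ne.symm h), Function.update_comm h]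
  rw [this]
  abel

theorem slotSum_add [Add X] {f : (Fin n → X) → M}
    (hf : ∀ b i u v, f (Function.update b i (u + v))
      = f (Function.update b i u) + f (Function.update b i v)) (φ ψ : X → X) (b : Fin n → X) :
    slotSum (fun x => φ x + ψ x) f b = slotSum φ f b + slotSum ψ f b := by
  simp [slotSum, hf, Finset.sum_add_distrib]

theorem slotSum_comp_perm {f : (Fin n → X) → M}
    (hf : ∀ (b : Fin n → X) (σ : Equiv.Perm (Fin n)), f (b ∘ σ) = f b) (φ : X → X) (b : Fin n → X)
    (σ : Equiv.Perm (Fin n)) : slotSum φ f (b ∘ σ) = slotSum φ f b := by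
  rw [slotSum, slotSum, ← Equiv.sum_comp σ fun i => f (Function.update b i (φ (b i)))]
  refine Finset.sum_congr rfl fun i _ => ?_
  rw [← hf (Function.update b (σ i) _) σ, Function.update_comp_equiv, Equiv.symm_apply_apply]
  rfl

end SlotSum

/-! ### Symmetric braces: additivity, symmetry, congruences -/

section Brace

variable {k : Type u} [CommRing k] {A : ℤ → Type v}
  [∀ n, AddCommGroup (A n)] [∀ n, Module k (A n)] (𝔭 : CompleteDGPreLie k A)

theorem brace_zero {m : ℤ} (a : A m) (b : Fin 0 → A 0) : 𝔭.brace 0 a b = a := rfl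

theorem brace_succ {m : ℤ} (n : ℕ) (a : A m) (b : Fin (n + 1) → A 0) :
    𝔭.brace (n + 1) a b = 𝔭.star (add_zero m) (𝔭.brace n a (Fin.init b)) (b (Fin.last n))
      - slotSum (fun z => 𝔭.star (add_zero 0) z (b (Fin.last n))) (𝔭.brace n a) (Fin.init b) :=
  rfl

theorem brace_snoc {m : ℤ} (n : ℕ) (a : A m) (b : Fin n → A 0) (x : A 0) :
    𝔭.brace (n + 1) a (Fin.snoc (α := fun _ => A 0) b x)
      = 𝔭.star (add_zero m) (𝔭.brace n a b) x
        - slotSum (fun z => 𝔭.star (add_zero 0) z x) (𝔭.brace n a) b := by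
  rw [brace_succ, Fin.init_snoc, Fin.snoc_last]

theorem brace_update_add {m : ℤ} (n : ℕ) (a : A m) : ∀ (b : Fin n → A 0) (i : Fin n) (u v : A 0),
    𝔭.brace n a (Function.update b i (u + v))
      = 𝔭.brace n a (Function.update b i u) + 𝔭.brace n a (Function.update b i v) := by
  induction n with
  | zero => exact fun _ i => i.elim0
  | succ n ih =>
    intro b i u v
    simp only [brace_succ]
    cases i using Fin.lastCases with
    | last =>
      simp only [Fin.init_update_last, Function.update_self, map_add, slotSum_add ih]
      abel
    | cast i =>
      have hne : Fin.last n ≠ i.castSucc := (Fin.castSucc_lt_last i).ne'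
      simp only [Fin.init_update_castSucc, Function.update_of_ne hne, ih, map_add,
        LinearMap.add_apply]
      have key : ∀ φ : A 0 → A 0, (∀ x y, φ (x + y) = φ x + φ y) →
          slotSum φ (𝔭.brace n a) (Function.update (Fin.init b) i (u + v))
          = slotSum φ (𝔭.brace n a) (Function.update (Fin.init b) i u)
            + slotSum φ (𝔭.brace n a) (Function.update (Fin.init b) i v) := by
        intro φ hφ
        simp only [slotSum]
        rw [← Finset.sum_add_distrib]
        refine Finset.sum_congr rfl fun j _ => ?_
        by_cases hj : j = i
        · subst hj
          simp [hφ, ih]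
        · simp only [Function.update_of_ne hj, Function.update_comm (Ne.symm hj), ih]
      rw [key _ fun x y => by simp]
      abel

/-- Unfolding both last slots leaves three groups of terms: the associator of `{a; b}` with `x` and
`y`, symmetric by right symmetry; a visibly symmetric pair of mixed terms; and iterated slot sums.
In the last group the failure to commute is diagonal and is absorbed by right symmetry applied to
each entry `z` of `b`. -/
theorem brace_snoc_snoc_swap {m : ℤ} (n : ℕ) (a : A m) (b : Fin n → A 0) (x y : A 0) :
    𝔭.brace (n + 2) a (Fin.snoc (α := fun _ => A 0) (Fin.snoc (α := fun _ => A 0) b x) y)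
      = 𝔭.brace (n + 2) a
        (Fin.snoc (α := fun _ => A 0) (Fin.snoc (α := fun _ => A 0) b y) x) := by
  have expand : ∀ x y : A 0,
      𝔭.brace (n + 2) a (Fin.snoc (α := fun _ => A 0) (Fin.snoc (α := fun _ => A 0) b x) y)
      = 𝔭.star (add_zero m) (𝔭.star (add_zero m) (𝔭.brace n a b) x) y
        - 𝔭.star (add_zero m) (𝔭.brace n a b) (𝔭.star (add_zero 0) x y)
        - 𝔭.star (add_zero m) (slotSum (fun z => 𝔭.star (add_zero 0) z x) (𝔭.brace n a) b) y
        - 𝔭.star (add_zero m) (slotSum (fun z => 𝔭.star (add_zero 0) z y) (𝔭.brace n a) b) x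
        + slotSum (fun z => 𝔭.star (add_zero 0) z y)
          (slotSum (fun z => 𝔭.star (add_zero 0) z x) (𝔭.brace n a)) b
        + slotSum (fun z => 𝔭.star (add_zero 0) z (𝔭.star (add_zero 0) x y)) (𝔭.brace n a) b := by
    intro x y
    rw [brace_snoc, brace_snoc]
    have : slotSum (fun z => 𝔭.star (add_zero 0) z y) (𝔭.brace (n + 1) a)
        (Fin.snoc (α := fun _ => A 0) b x)
        = 𝔭.star (add_zero m) (slotSum (fun z => 𝔭.star (add_zero 0) z y) (𝔭.brace n a) b) x
          - slotSum (fun z => 𝔭.star (add_zero 0) z y)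
          (slotSum (fun z => 𝔭.star (add_zero 0) z x) (𝔭.brace n a)) b
          + (𝔭.star (add_zero m) (𝔭.brace n a b) (𝔭.star (add_zero 0) x y)
          - slotSum (fun z => 𝔭.star (add_zero 0) z (𝔭.star (add_zero 0) x y))
            (𝔭.brace n a) b) := by
      rw [slotSum, Fin.sum_univ_castSucc]
      simp only [Fin.snoc_castSucc, Fin.snoc_last, Fin.update_snoc_last, ← Fin.snoc_update,
        brace_snoc, Finset.sum_sub_distrib]
      congr 2
      rw [slotSum, map_sum, LinearMap.sum_apply]
    rw [this, map_sub, LinearMap.sub_apply]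
    abel
  rw [expand x y, expand y x]
  have h1 := 𝔭.right_symm (add_zero m) (add_zero m) (add_zero 0) (show m + 0 + 0 = m by simp)
    (𝔭.brace n a b) x y
  simp only [mul_zero, Int.negOnePow_zero, one_smul] at h1
  have h2 := slotSum_comm (fun z => 𝔭.star (add_zero 0) z y) (fun z => 𝔭.star (add_zero 0) z x)
    (𝔭.brace n a) b
  have h3 := slotSum_add (𝔭.brace_update_add n a)
    (fun z => 𝔭.star (add_zero 0) (𝔭.star (add_zero 0) z y) x)
    (fun z => 𝔭.star (add_zero 0) z (𝔭.star (add_zero 0) x y)) b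
  have h4 := slotSum_add (𝔭.brace_update_add n a)
    (fun z => 𝔭.star (add_zero 0) (𝔭.star (add_zero 0) z x) y)
    (fun z => 𝔭.star (add_zero 0) z (𝔭.star (add_zero 0) y x)) b
  have h5 : (fun z => 𝔭.star (add_zero 0) (𝔭.star (add_zero 0) z y) x
      + 𝔭.star (add_zero 0) z (𝔭.star (add_zero 0) x y))
      = (fun z => 𝔭.star (add_zero 0) (𝔭.star (add_zero 0) z x) y
      + 𝔭.star (add_zero 0) z (𝔭.star (add_zero 0) y x)) := by
    funext z
    have h := 𝔭.right_symm (add_zero 0) (add_zero 0) (add_zero 0) (show (0 : ℤ) + 0 + 0 = 0 by simp)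
      z x y
    simp only [mul_zero, Int.negOnePow_zero, one_smul] at h
    rw [sub_eq_sub_iff_add_eq_add] at h
    rw [← h]
  rw [h5, h4] at h3
  rw [h1]
  generalize slotSum (fun z => 𝔭.star (add_zero 0) z y)
    (slotSum (fun z => 𝔭.star (add_zero 0) z x) (𝔭.brace n a)) b = p1 at *
  generalize slotSum (fun z => 𝔭.star (add_zero 0) z x)
    (slotSum (fun z => 𝔭.star (add_zero 0) z y) (𝔭.brace n a)) b = p2 at *
  have h6 : p1 + slotSum (fun z => 𝔭.star (add_zero 0) z (𝔭.star (add_zero 0) x y)) (𝔭.brace n a) b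
      = p2 + slotSum (fun z => 𝔭.star (add_zero 0) z (𝔭.star (add_zero 0) y x))
        (𝔭.brace n a) b := by
    linear_combination (norm := abel) h2 - h3
  rw [add_assoc, h6]
  abel

/-- The symmetric braces are symmetric. -/
theorem brace_comp_perm {m : ℤ} (a : A m) : ∀ (n : ℕ) (b : Fin n → A 0)
    (σ : Equiv.Perm (Fin n)), 𝔭.brace n a (b ∘ σ) = 𝔭.brace n a b
  | 0, b, σ => rfl
  | 1, b, σ => by rw [Subsingleton.elim σ 1]; rfl
  | n + 2, b, σ => by
    have ih := brace_comp_perm a (n + 1)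
    -- Adjacent transpositions generate the symmetric group. The one moving the last slot is
    -- `brace_snoc_snoc_swap`; the others are handled by induction on the length.
    have hσ : σ ∈ Submonoid.closure
        (Set.range fun i : Fin (n + 1) => Equiv.swap i.castSucc i.succ) := by
      rw [Equiv.Perm.mclosure_swap_castSucc_succ]
      trivial
    induction hσ using Submonoid.closure_induction generalizing b with
    | one => rfl
    | mul σ τ _ _ h1 h2 =>
      exact (h2 (b ∘ σ)).trans (h1 b)
    | mem σ h =>
      obtain ⟨i, rfl⟩ := h
      cases i using Fin.lastCases with
      | last =>
        obtain ⟨b, y, rfl⟩ : ∃ b' y, b = Fin.snoc (α := fun _ => A 0) b' y :=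
          ⟨Fin.init b, b (Fin.last _), (Fin.snoc_init_self b).symm⟩
        obtain ⟨b, x, rfl⟩ : ∃ b' y, b = Fin.snoc (α := fun _ => A 0) b' y :=
          ⟨Fin.init b, b (Fin.last _), (Fin.snoc_init_self b).symm⟩
        rw [brace_snoc_snoc_swap]
        congr 1
        funext j
        cases j using Fin.lastCases with
        | last => simp
        | cast j =>
          cases j using Fin.lastCases with
          | last => simp
          | cast j =>
            have h1 : j.castSucc.castSucc ≠ (Fin.last n).castSucc := by
              simp [Fin.ext_iff, j.isLt.ne]
            have h2 : j.castSucc.castSucc ≠ (Fin.last n).succ := by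
              simp [Fin.ext_iff]; omega
            rw [Function.comp_apply, Equiv.swap_apply_of_ne_of_ne h1 h2]
            simp
      | cast i =>
        have hinit : Fin.init (α := fun _ => A 0)
            (b ∘ Equiv.swap i.castSucc.castSucc i.castSucc.succ)
            = Fin.init (α := fun _ => A 0) b ∘ Equiv.swap i.castSucc i.succ := by
          funext j
          simp only [Fin.init, Function.comp_apply]
          congr 1
          simp only [Equiv.swap_apply_def, Fin.ext_iff]
          split_ifs <;> simp_all
        have hlast : Equiv.swap i.castSucc.castSucc i.castSucc.succ (Fin.last (n + 1))
            = Fin.last (n + 1) := by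
          refine Equiv.swap_apply_of_ne_of_ne ?_ ?_ <;> simp [Fin.ext_iff] <;> omega
        rw [brace_succ, brace_succ _ _ _ b, hinit, Function.comp_apply, hlast, ih,
          slotSum_comp_perm ih]

/-- By symmetry all slots contribute equally; the factor `n + 1` turns `1 / (n+1)!` into `1 / n!` in
the flow equation. -/
theorem slotSum_const_brace {m : ℤ} (n : ℕ) (a : A m) (c x : A 0) :
    slotSum (fun _ => x) (𝔭.brace (n + 1) a) (fun _ => c)
      = (n + 1) • 𝔭.brace (n + 1) a (Fin.snoc (α := fun _ => A 0) (fun _ => c) x) := by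
  have : ∀ i : Fin (n + 1), 𝔭.brace (n + 1) a (Function.update (fun _ => c) i x)
      = 𝔭.brace (n + 1) a (Fin.snoc (α := fun _ => A 0) (fun _ => c) x) := by
    intro i
    rw [← 𝔭.brace_comp_perm a (n + 1) (Fin.snoc (α := fun _ => A 0) (fun _ => c) x)
      (Equiv.swap i (Fin.last n))]
    congr 1
    funext j
    by_cases hj : j = i
    · subst hj; simp
    · rw [Function.update_of_ne hj, Function.comp_apply]
      have : Equiv.swap i (Fin.last n) j ≠ Fin.last n := by
        intro h
        apply hj
        exact (Equiv.swap i (Fin.last n)).injective (h.trans (Equiv.swap_apply_left _ _).symm)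
      obtain ⟨l, hl⟩ := Fin.exists_castSucc_eq.2 this
      rw [← hl, Fin.snoc_castSucc]
  simp [slotSum, this]

/-- The braces are compatible with congruence modulo `F_i`. -/
theorem brace_sub_mem {m : ℤ} (i : ℕ) : ∀ (n : ℕ) {a a' : A m} {b b' : Fin n → A 0},
    a - a' ∈ 𝔭.F i m → (∀ l, b l - b' l ∈ 𝔭.F i 0) →
    𝔭.brace n a b - 𝔭.brace n a' b' ∈ 𝔭.F i m
  | 0, _, _, _, _, ha, _ => ha
  | n + 1, a, a', b, b', ha, hb => by
    have hstar : ∀ {m : ℤ} {x x' : A m} {y y' : A 0}, x - x' ∈ 𝔭.F i m → y - y' ∈ 𝔭.F i 0 →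
        𝔭.star (add_zero m) x y - 𝔭.star (add_zero m) x' y' ∈ 𝔭.F i m := by
      intro m x x' y y' hx hy
      have h1 := 𝔭.star_mem (add_zero m) i 0 _ y hx (mem_F_zero _)
      have h2 := 𝔭.star_mem (add_zero m) 0 i x' _ (mem_F_zero _) hy
      simp only [map_sub, LinearMap.sub_apply, add_zero, zero_add] at h1 h2
      exact sub_mem_trans h1 h2
    simp only [brace_succ]
    rw [sub_sub_sub_comm]
    refine sub_mem (hstar (brace_sub_mem i n ha fun l => hb _) (hb _)) ?_
    rw [slotSum, slotSum, ← Finset.sum_sub_distrib]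
    refine Submodule.sum_mem _ fun j _ => brace_sub_mem i n ha fun l => ?_
    by_cases hl : l = j
    · subst hl
      simpa [Fin.init] using hstar (hb l.castSucc) (hb (Fin.last n))
    · simpa [Function.update_of_ne hl, Fin.init] using hb l.castSucc

variable [Algebra ℚ k] {𝔭}

/-- The source of all continuity statements: the congruence holds term by term with no loss of
filtration. -/
theorem circOneAdd_sub_mem {m : ℤ} {i : ℕ} {a a' : A m} {b b' : A 0} (hb : b ∈ 𝔭.F 1 0)
    (hb' : b' ∈ 𝔭.F 1 0) (haa : a - a' ∈ 𝔭.F i m) (hbb : b - b' ∈ 𝔭.F i 0) :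
    𝔭.circOneAdd a b - 𝔭.circOneAdd a' b' ∈ 𝔭.F i m := by
  refine ((𝔭.isSeriesSum_circOneAdd a b hb).sub
    (𝔭.isSeriesSum_circOneAdd a' b' hb')).mem i fun j => ?_
  rw [← smul_sub]
  exact Submodule.smul_mem _ _ (𝔭.brace_sub_mem i j haa fun _ => hbb)

end Brace

/-! ### Morphisms commute with braces, powers and their series -/

section Hom

variable {k : Type u} [CommRing k] {A : ℤ → Type v}
  [∀ n, AddCommGroup (A n)] [∀ n, Module k (A n)] {B : ℤ → Type w}
  [∀ n, AddCommGroup (B n)] [∀ n, Module k (B n)]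

/-- Filtered morphisms of graded pre-Lie algebras. -/
structure Hom (𝔭 : CompleteDGPreLie k A) (𝔮 : CompleteDGPreLie k B) where
  /-- The components of the morphism. -/
  toFun : ∀ n, A n →ₗ[k] B n
  map_mem : ∀ i n a, a ∈ 𝔭.F i n → toFun n a ∈ 𝔮.F i n
  map_star : ∀ {p q n : ℤ} (h : p + q = n) (a : A p) (b : A q),
    toFun n (𝔭.star h a b) = 𝔮.star h (toFun p a) (toFun q b)

namespace Hom

variable {𝔭 : CompleteDGPreLie k A} {𝔮 : CompleteDGPreLie k B} (φ : Hom 𝔭 𝔮)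

theorem map_brace {m : ℤ} (a : A m) : ∀ (n : ℕ) (b : Fin n → A 0),
    φ.toFun m (𝔭.brace n a b) = 𝔮.brace n (φ.toFun m a) (fun i => φ.toFun 0 (b i))
  | 0, _ => rfl
  | n + 1, b => by
    rw [brace_succ, brace_succ, map_sub, φ.map_star, map_brace a n, slotSum, map_sum]
    congr 1
    refine Finset.sum_congr rfl fun i _ => ?_
    rw [map_brace a n]
    congr 1
    funext l
    by_cases hl : l = i
    · subst hl
      simp [Fin.init, φ.map_star]
    · simp [Function.update_of_ne hl, Fin.init]

theorem map_pow (l : A 0) (n : ℕ) : φ.toFun 0 (𝔭.pow l n) = 𝔮.pow (φ.toFun 0 l) n := by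
  induction n with
  | zero => rfl
  | succ n ih => rw [pow, pow, φ.map_star, ih]

variable [Algebra ℚ k]

theorem map_circOneAdd {m : ℤ} (a : A m) {b : A 0} (hb : b ∈ 𝔭.F 1 0) :
    φ.toFun m (𝔭.circOneAdd a b) = 𝔮.circOneAdd (φ.toFun m a) (φ.toFun 0 b) := by
  refine (IsSeriesSum.seriesSum_eq (𝔭 := 𝔮) ?_).symm
  simpa [φ.map_brace] using
    (𝔭.isSeriesSum_circOneAdd a b hb).map (𝔮 := 𝔮) (φ.toFun m) fun i => φ.map_mem i m

theorem map_expSubOne {l : A 0} (hl : l ∈ 𝔭.F 1 0) :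
    φ.toFun 0 (𝔭.expSubOne l) = 𝔮.expSubOne (φ.toFun 0 l) := by
  refine (IsSeriesSum.seriesSum_eq (𝔭 := 𝔮) ?_).symm
  simpa [φ.map_pow] using
    (𝔭.isSeriesSum_expSubOne l hl).map (𝔮 := 𝔮) (φ.toFun 0) fun i => φ.map_mem i 0

end Hom

end Hom

/-! ### Exponential power series and the flow equation -/

section SeqAlgebra

variable {k : Type u} [CommRing k] {A : ℤ → Type v}
  [∀ n, AddCommGroup (A n)] [∀ n, Module k (A n)] (𝔭 : CompleteDGPreLie k A)

/-- The graded module of exponential power series `∑ x_j t^j / j!` with `x_j` in `F_j`. -/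
abbrev Seq (n : ℤ) : Type v := Submodule.pi Set.univ fun j => 𝔭.F j n

/-- The coefficient of `t^N / N!` in the product of two exponential power series. -/
def seqStar {p q n : ℤ} (h : p + q = n) (N : ℕ) (x : ℕ → A p) (y : ℕ → A q) : A n :=
  ∑ i ∈ Finset.HasAntidiagonal.antidiagonal N, N.choose i.1 • 𝔭.star h (x i.1) (y i.2)

theorem seqStar_zero {p q n : ℤ} (h : p + q = n) (x : ℕ → A p) (y : ℕ → A q) :
    𝔭.seqStar h 0 x y = 𝔭.star h (x 0) (y 0) := by
  simp [seqStar]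

/-- This is the Leibniz rule for `d/dt`, since the shift of coefficients is the derivative. It
drives the inductions on `N` below. -/
theorem seqStar_succ {p q n : ℤ} (h : p + q = n) (N : ℕ) (x : ℕ → A p) (y : ℕ → A q) :
    𝔭.seqStar h (N + 1) x y
      = 𝔭.seqStar h N (fun j => x (j + 1)) y + 𝔭.seqStar h N x (fun j => y (j + 1)) := by
  rw [seqStar, Finset.sum_antidiagonal_choose_succ_nsmul (fun i j => 𝔭.star h (x i) (y j)),
    add_comm]
  congr 1
  refine Finset.sum_congr rfl fun p hp => ?_
  rw [Nat.choose_symm_of_eq_add (Finset.HasAntidiagonal.mem_antidiagonal.1 hp).symm]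

theorem seqStar_mem {p q n : ℤ} (h : p + q = n) (N i j : ℕ) (x : ℕ → A p) (y : ℕ → A q)
    (hx : ∀ l, x l ∈ 𝔭.F (max i l) p) (hy : ∀ l, y l ∈ 𝔭.F (max j l) q) :
    𝔭.seqStar h N x y ∈ 𝔭.F (max (i + j) N) n := by
  refine Submodule.sum_mem _ fun a ha => nsmul_mem ?_ _
  have := Finset.HasAntidiagonal.mem_antidiagonal.1 ha
  exact F_le (by omega) (𝔭.star_mem h _ _ _ _ (hx a.1) (hy a.2))

theorem seqStar_add_left {p q n : ℤ} (h : p + q = n) (N : ℕ) (x x' : ℕ → A p) (y : ℕ → A q) :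
    𝔭.seqStar h N (fun j => x j + x' j) y = 𝔭.seqStar h N x y + 𝔭.seqStar h N x' y := by
  simp [seqStar, Finset.sum_add_distrib]

theorem seqStar_add_right {p q n : ℤ} (h : p + q = n) (N : ℕ) (x : ℕ → A p) (y y' : ℕ → A q) :
    𝔭.seqStar h N x (fun j => y j + y' j) = 𝔭.seqStar h N x y + 𝔭.seqStar h N x y' := by
  simp [seqStar, Finset.sum_add_distrib]

theorem seqStar_smul_left {p q n : ℤ} (h : p + q = n) (N : ℕ) (c : k) (x : ℕ → A p)
    (y : ℕ → A q) : 𝔭.seqStar h N (fun j => c • x j) y = c • 𝔭.seqStar h N x y := by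
  simp [seqStar, Finset.smul_sum, smul_comm c]

theorem seqStar_smul_right {p q n : ℤ} (h : p + q = n) (N : ℕ) (c : k) (x : ℕ → A p)
    (y : ℕ → A q) : 𝔭.seqStar h N x (fun j => c • y j) = c • 𝔭.seqStar h N x y := by
  simp [seqStar, Finset.smul_sum, smul_comm c]

/-- Differentiating the identity in `t` gives the same identity for three triples, so induction on
`N` reduces it to the constant terms. -/
theorem seqStar_right_symm {p q r pq pr qr n : ℤ} (hpq : p + q = pq) (hpr : p + r = pr)
    (hqr : q + r = qr) (hn : p + q + r = n) (N : ℕ) :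
    ∀ (x : ℕ → A p) (y : ℕ → A q) (z : ℕ → A r),
    𝔭.seqStar (show pq + r = n by omega) N (fun M => 𝔭.seqStar hpq M x y) z
        - 𝔭.seqStar (show p + qr = n by omega) N x (fun M => 𝔭.seqStar hqr M y z)
      = (q * r).negOnePow •
        (𝔭.seqStar (show pr + q = n by omega) N (fun M => 𝔭.seqStar hpr M x z) y
          - 𝔭.seqStar (show p + qr = n by omega) N x
            (fun M => 𝔭.seqStar (show r + q = qr by omega) M z y)) := by
  induction N with
  | zero =>
    intro x y z
    simp only [seqStar_zero, 𝔭.right_symm hpq hpr hqr hn]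
  | succ N ih =>
    intro x y z
    simp only [seqStar_succ, seqStar_add_left, seqStar_add_right]
    have h1 := ih (fun j => x (j + 1)) y z
    have h2 := ih x (fun j => y (j + 1)) z
    have h3 := ih x y (fun j => z (j + 1))
    have h4 := congrArg₂ (· + ·) (congrArg₂ (· + ·) h1 h2) h3
    simp only [← smul_add] at h4
    convert h4 using 1
    · abel
    · congr 1
      abel

/-- The complete pre-Lie algebra of exponential power series, with zero differential. -/
def seqAlgebra : CompleteDGPreLie k 𝔭.Seq where
  -- The maximum records both the growth condition on coefficients, needed for convergence at `t =
  -- 1`, and the filtration pulled back from `A`.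
  F i n := (Submodule.pi Set.univ fun j => 𝔭.F (max i j) n).comap (Submodule.subtype _)
  F_zero n := by
    rw [eq_top_iff]
    rintro x -
    exact fun j hj => by simpa using x.2 j hj
  F_succ_le i n := by
    intro x hx j hj
    exact F_le (by omega) (hx j hj)
  separated n x hx := by
    refine Subtype.ext (funext fun j => 𝔭.separated n _ fun i => ?_)
    exact F_le (le_max_left _ _) (hx i j trivial)
  complete n x hx := by
    have hex : ∀ j, ∃ y, ∀ i, y - (x i).1 j ∈ 𝔭.F i n := fun j =>
      𝔭.complete n (fun i => (x i).1 j) fun i => F_le (le_max_left _ _) (hx i j trivial)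
    choose y hy using hex
    have hmem : ∀ j, y j ∈ 𝔭.F j n := fun j => by
      simpa using add_mem (hy j j) ((x j).2 j trivial)
    refine ⟨⟨y, fun j _ => hmem j⟩, fun i j _ => ?_⟩
    change y j - (x i).1 j ∈ 𝔭.F (max i j) n
    rcases le_total i j with hij | hij
    · rw [max_eq_right hij]
      exact sub_mem (hmem j) ((x i).2 j trivial)
    · rw [max_eq_left hij]
      exact hy j i
  d _ := 0
  d_mem h i a _ := zero_mem _
  d_d h h' a := rfl
  star {p q n} h := LinearMap.mk₂ k
    (fun x y => ⟨fun N => 𝔭.seqStar h N x.1 y.1, fun N _ => by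
      simpa using 𝔭.seqStar_mem h N 0 0 x.1 y.1 (fun l => by simpa using x.2 l trivial)
        (fun l => by simpa using y.2 l trivial)⟩)
    (fun x x' y => Subtype.ext (funext fun N => 𝔭.seqStar_add_left h N x.1 x'.1 y.1))
    (fun c x y => Subtype.ext (funext fun N => 𝔭.seqStar_smul_left h N c x.1 y.1))
    (fun x y y' => Subtype.ext (funext fun N => 𝔭.seqStar_add_right h N x.1 y.1 y'.1))
    (fun c x y => Subtype.ext (funext fun N => 𝔭.seqStar_smul_right h N c x.1 y.1))
  star_mem h i j a b ha hb := fun N _ => 𝔭.seqStar_mem h N i j a.1 b.1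
    (fun l => ha l trivial) (fun l => hb l trivial)
  d_star h hp hq hn a b := by
    rw [LinearMap.zero_apply, LinearMap.zero_apply, LinearMap.zero_apply, map_zero, map_zero,
      LinearMap.zero_apply, smul_zero, add_zero]
  right_symm hpq hpr hqr hn a b c :=
    Subtype.ext (funext fun N => 𝔭.seqStar_right_symm hpq hpr hqr hn N a.1 b.1 c.1)

theorem mem_seqAlgebra_F {i : ℕ} {n : ℤ} {x : 𝔭.Seq n} :
    x ∈ 𝔭.seqAlgebra.F i n ↔ ∀ j, x.1 j ∈ 𝔭.F (max i j) n :=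
  ⟨fun h j => h j trivial, fun h j _ => h j⟩

theorem seqAlgebra_star_apply {p q n : ℤ} (h : p + q = n) (x : 𝔭.Seq p) (y : 𝔭.Seq q) (N : ℕ) :
    (𝔭.seqAlgebra.star h x y).1 N = 𝔭.seqStar h N x.1 y.1 := rfl

/-- The derivative of an exponential power series. -/
def seqDeriv (n : ℤ) : 𝔭.Seq n →ₗ[k] 𝔭.Seq n where
  toFun x := ⟨fun j => x.1 (j + 1), fun j _ => F_le (Nat.le_succ j) (x.2 (j + 1) trivial)⟩
  map_add' _ _ := rfl
  map_smul' _ _ := rfl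

theorem seqDeriv_apply {n : ℤ} (x : 𝔭.Seq n) (j : ℕ) : (𝔭.seqDeriv n x).1 j = x.1 (j + 1) := rfl

theorem seqDeriv_mem (i : ℕ) (n : ℤ) (x : 𝔭.Seq n) (hx : x ∈ 𝔭.seqAlgebra.F i n) :
    𝔭.seqDeriv n x ∈ 𝔭.seqAlgebra.F i n := by
  rw [mem_seqAlgebra_F] at hx ⊢
  exact fun j => F_le (by omega) (hx (j + 1))

theorem seqDeriv_star {p q n : ℤ} (h : p + q = n) (x : 𝔭.Seq p) (y : 𝔭.Seq q) :
    𝔭.seqDeriv n (𝔭.seqAlgebra.star h x y)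
      = 𝔭.seqAlgebra.star h (𝔭.seqDeriv p x) y + 𝔭.seqAlgebra.star h x (𝔭.seqDeriv q y) :=
  Subtype.ext (funext fun N => 𝔭.seqStar_succ h N x.1 y.1)

/-- The constant power series. -/
def seqConst {n : ℤ} (x : A n) : 𝔭.Seq n :=
  ⟨fun j => Nat.casesOn j x fun _ => 0, fun j _ => by
    cases j with
    | zero => exact mem_F_zero x
    | succ j => exact zero_mem _⟩

theorem seqDeriv_seqConst {n : ℤ} (x : A n) : 𝔭.seqDeriv n (𝔭.seqConst x) = 0 := rfl

theorem seqStar_seqConst {p q n : ℤ} (h : p + q = n) (y : A q) (N : ℕ) : ∀ x : ℕ → A p,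
    𝔭.seqStar h N x (𝔭.seqConst y).1 = 𝔭.star h (x N) y := by
  induction N with
  | zero => exact fun x => 𝔭.seqStar_zero h x _
  | succ N ih =>
    intro x
    rw [seqStar_succ, ih]
    have : 𝔭.seqStar h N x (fun j => (𝔭.seqConst y).1 (j + 1)) = 0 := by
      simp [seqStar, seqConst]
    rw [this, add_zero]

/-- Evaluation at `t = 0`, as a morphism. -/
def seqEvalZero : Hom 𝔭.seqAlgebra 𝔭 where
  toFun _ :=
    { toFun := fun x => x.1 0
      map_add' := fun _ _ => rfl
      map_smul' := fun _ _ => rfl }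
  map_mem _ _ _ ha := F_le (le_max_left _ _) (𝔭.mem_seqAlgebra_F.1 ha 0)
  map_star h x y := 𝔭.seqStar_zero h x.1 y.1

/-- The coefficients of the curve `e^{t R_l} (1 + b) - 1`. -/
def expCurveCoeff (l b : A 0) : ℕ → A 0
  | 0 => b
  | j + 1 => 𝔭.pow l j + (𝔭.rightMul 0 l)^[j + 1] b

theorem expCurveCoeff_mem (l b : A 0) (hl : l ∈ 𝔭.F 1 0) :
    ∀ j, 𝔭.expCurveCoeff l b j ∈ 𝔭.F j 0
  | 0 => mem_F_zero b
  | j + 1 => by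
    have := (raises_rightMul 0 hl).iterate_mem (mem_F_zero b) (j + 1)
    rw [zero_add] at this
    exact add_mem (𝔭.pow_mem l hl j) this

/-- The curve `e^{t R_l} (1 + b) - 1`. -/
def expCurve (l b : A 0) (hl : l ∈ 𝔭.F 1 0) : 𝔭.Seq 0 :=
  ⟨𝔭.expCurveCoeff l b, fun j _ => 𝔭.expCurveCoeff_mem l b hl j⟩

variable {𝔭} in
theorem expCurve_mem {l b : A 0} (hl : l ∈ 𝔭.F 1 0) (hb : b ∈ 𝔭.F 1 0) :
    𝔭.expCurve l b hl ∈ 𝔭.seqAlgebra.F 1 0 := by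
  rw [mem_seqAlgebra_F]
  intro j
  cases j with
  | zero => exact hb
  | succ j => rw [max_eq_right (by omega)]; exact (𝔭.expCurve l b hl).2 _ trivial

variable {𝔭} in
theorem seqConst_mem {l : A 0} (hl : l ∈ 𝔭.F 1 0) : 𝔭.seqConst l ∈ 𝔭.seqAlgebra.F 1 0 := by
  rw [mem_seqAlgebra_F]
  intro j
  cases j with
  | zero => exact hl
  | succ j => exact zero_mem _

-- The curve `c` solves `c' = (1 + c) ⋆ l`. The summand `l` comes from the formal unit and enters
-- only the constant coefficient.
variable {𝔭} in
theorem seqDeriv_expCurve {l : A 0} (b : A 0) (hl : l ∈ 𝔭.F 1 0) :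
    𝔭.seqDeriv 0 (𝔭.expCurve l b hl) = 𝔭.seqConst l
      + 𝔭.seqAlgebra.star (add_zero 0) (𝔭.expCurve l b hl) (𝔭.seqConst l) := by
  refine Subtype.ext (funext fun j => ?_)
  rw [seqDeriv_apply]
  change 𝔭.expCurveCoeff l b (j + 1)
    = (𝔭.seqConst l).1 j + 𝔭.seqStar _ j (𝔭.expCurveCoeff l b) _
  rw [seqStar_seqConst]
  cases j with
  | zero => rfl
  | succ j =>
    have h0 : (𝔭.seqConst l).1 (j + 1) = 0 := rfl
    rw [h0, zero_add, expCurveCoeff, expCurveCoeff, pow, Function.iterate_succ_apply', map_add,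
      LinearMap.add_apply, rightMul_apply]

/-- A degreewise derivation of the pre-Lie product acts on the braces by the Leibniz rule. -/
theorem derivation_brace {D : ∀ n, A n →ₗ[k] A n}
    (hD : ∀ {p q n : ℤ} (h : p + q = n) (x : A p) (y : A q),
      D n (𝔭.star h x y) = 𝔭.star h (D p x) y + 𝔭.star h x (D q y))
    {m : ℤ} {a : A m} (ha : D m a = 0) (n : ℕ) : ∀ b : Fin n → A 0,
    D m (𝔭.brace n a b) = slotSum (D 0) (𝔭.brace n a) b := by
  induction n with
  | zero => intro b; simp [slotSum, brace_zero, ha]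
  | succ n ih =>
    intro b
    obtain ⟨b, x, rfl⟩ : ∃ b' y, b = Fin.snoc (α := fun _ => A 0) b' y :=
      ⟨Fin.init b, b (Fin.last _), (Fin.snoc_init_self b).symm⟩
    have e : slotSum (D 0) (𝔭.brace (n + 1) a) (Fin.snoc (α := fun _ => A 0) b x)
        = 𝔭.star (add_zero m) (slotSum (D 0) (𝔭.brace n a) b) x
          - slotSum (D 0) (slotSum (fun z => 𝔭.star (add_zero 0) z x) (𝔭.brace n a)) b
          + (𝔭.star (add_zero m) (𝔭.brace n a b) (D 0 x)
          - slotSum (fun z => 𝔭.star (add_zero 0) z (D 0 x)) (𝔭.brace n a) b) := by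
      rw [slotSum, Fin.sum_univ_castSucc]
      simp only [Fin.snoc_castSucc, Fin.snoc_last, Fin.update_snoc_last, ← Fin.snoc_update,
        brace_snoc, Finset.sum_sub_distrib]
      congr 2
      rw [slotSum, map_sum, LinearMap.sum_apply]
    have e2 : D m (slotSum (fun z => 𝔭.star (add_zero 0) z x) (𝔭.brace n a) b)
        = slotSum (fun z => 𝔭.star (add_zero 0) z x) (slotSum (D 0) (𝔭.brace n a)) b := by
      rw [slotSum, map_sum]
      exact Finset.sum_congr rfl fun i _ => ih _
    -- The diagonal defect is `D (z ⋆ x) - D z ⋆ x = z ⋆ D x`, which matches the slot correction of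
    -- the brace ending in `D x`.
    have h1 := slotSum_comm (D 0) (fun z => 𝔭.star (add_zero 0) z x) (𝔭.brace n a) b
    have h2 := slotSum_add (𝔭.brace_update_add n a) (fun z => 𝔭.star (add_zero 0) (D 0 z) x)
      (fun z => 𝔭.star (add_zero 0) z (D 0 x)) b
    simp only [hD] at h1
    rw [e, brace_snoc, map_sub, hD, ih, e2]
    rw [h2] at h1
    linear_combination (norm := abel) h1

variable [Algebra ℚ k]

/-- Evaluation of an exponential power series at `t = 1`. -/
noncomputable def seqEvalFun {n : ℤ} (x : 𝔭.Seq n) : A n :=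
  𝔭.seriesSum fun j => invFact k j • x.1 j

theorem isSeriesSum_seqEvalFun {n : ℤ} (x : 𝔭.Seq n) :
    𝔭.IsSeriesSum (fun j => invFact k j • x.1 j) (𝔭.seqEvalFun x) :=
  𝔭.isSeriesSum_seriesSum fun i => Submodule.smul_mem _ _ (x.2 i trivial)

/-- Evaluation at `t = 1`, as a morphism. -/
noncomputable def seqEval : Hom 𝔭.seqAlgebra 𝔭 where
  toFun n :=
    { toFun := 𝔭.seqEvalFun
      map_add' := fun x y => IsSeriesSum.seriesSum_eq (by
        simpa using (𝔭.isSeriesSum_seqEvalFun x).add (𝔭.isSeriesSum_seqEvalFun y))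
      map_smul' := fun c x => IsSeriesSum.seriesSum_eq (by
        simpa [smul_comm c] using (𝔭.isSeriesSum_seqEvalFun x).smul c) }
  map_mem i n a ha := (𝔭.isSeriesSum_seqEvalFun a).mem i fun j =>
    Submodule.smul_mem _ _ (F_le (le_max_left _ _) (𝔭.mem_seqAlgebra_F.1 ha j))
  map_star {p q n} h x y := by
    refine IsSeriesSum.seriesSum_eq ?_
    have key := IsSeriesSum.antidiagonal (𝔭 := 𝔭)
      (C := fun i j => 𝔭.star h (invFact k i • x.1 i) (invFact k j • y.1 j))
      (r := fun i => 𝔭.star h (invFact k i • x.1 i) (𝔭.seqEvalFun y))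
      (s := 𝔭.star h (𝔭.seqEvalFun x) (𝔭.seqEvalFun y))
      (fun i j => 𝔭.star_mem h i j _ _ (Submodule.smul_mem _ _ (x.2 i trivial))
        (Submodule.smul_mem _ _ (y.2 j trivial)))
      (fun i => (𝔭.isSeriesSum_seqEvalFun y).map (𝔭.star h (invFact k i • x.1 i))
        fun a z hz => by
          have := 𝔭.star_mem h 0 a (invFact k i • x.1 i) z (mem_F_zero _) hz
          rwa [zero_add] at this)
      ((𝔭.isSeriesSum_seqEvalFun x).map ((𝔭.star h).flip (𝔭.seqEvalFun y))
        fun a z hz => by simpa using 𝔭.star_mem h a 0 _ _ hz (mem_F_zero _))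
    change 𝔭.IsSeriesSum _ (𝔭.star h (𝔭.seqEvalFun x) (𝔭.seqEvalFun y))
    convert key using 2 with N
    rw [seqAlgebra_star_apply, seqStar, Finset.smul_sum]
    refine Finset.sum_congr rfl fun i hi => ?_
    rw [← Nat.cast_smul_eq_nsmul k, smul_smul,
      invFact_mul_choose k (Finset.HasAntidiagonal.mem_antidiagonal.1 hi), map_smul, map_smul,
      LinearMap.smul_apply, smul_smul, mul_comm]

variable {𝔭}

theorem seqEval_seqConst {n : ℤ} (x : A n) : 𝔭.seqEval.toFun n (𝔭.seqConst x) = x := by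
  have := IsSeriesSum.of_eq_zero (𝔭 := 𝔭) (x := fun j => invFact k j • (𝔭.seqConst x).1 j)
    (fun j => smul_zero _)
  exact this.seriesSum_eq.trans (by rw [invFact_zero, one_smul]; rfl)

theorem seqEval_expCurve {l : A 0} (b : A 0) (hl : l ∈ 𝔭.F 1 0) :
    𝔭.seqEval.toFun 0 (𝔭.expCurve l b hl)
      = 𝔭.expSubOne l + 𝔭.expOp (𝔭.rightMul 0 l) b := by
  refine IsSeriesSum.seriesSum_eq ?_
  have h1 := IsSeriesSum.cons (𝔭 := 𝔭) (x := fun j => invFact k j •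
    (𝔭.expCurveCoeff l b j - (𝔭.rightMul 0 l)^[j] b)) (s := 𝔭.expSubOne l) (by
      simp only [expCurveCoeff, add_sub_cancel_right]
      exact 𝔭.isSeriesSum_expSubOne l hl)
  have h2 := h1.add ((raises_rightMul 0 hl).isSeriesSum_expOp b)
  simp only [← smul_add, sub_add_cancel] at h2
  rw [expCurveCoeff, Function.iterate_zero, id, sub_self, smul_zero, zero_add] at h2
  exact h2

/-- The flow equation satisfied by the circle product along a flow line `c` of `x ↦ (1 + x) ⋆ l`. -/
theorem derivation_circOneAdd {D : ∀ n, A n →ₗ[k] A n}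
    (hD : ∀ {p q n : ℤ} (h : p + q = n) (x : A p) (y : A q),
      D n (𝔭.star h x y) = 𝔭.star h (D p x) y + 𝔭.star h x (D q y))
    {m : ℤ} (hDF : ∀ i x, x ∈ 𝔭.F i m → D m x ∈ 𝔭.F i m) {a : A m} (ha : D m a = 0)
    {l c : A 0} (hl : l ∈ 𝔭.F 1 0) (hcmem : c ∈ 𝔭.F 1 0)
    (hc : D 0 c = l + 𝔭.star (add_zero 0) c l) :
    D m (𝔭.circOneAdd a c) = 𝔭.star (add_zero m) (𝔭.circOneAdd a c) l := by
  have hS := 𝔭.isSeriesSum_circOneAdd a c hcmem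
  have h1 := hS.map (𝔮 := 𝔭) (D m - 𝔭.rightMul m l) fun i x hx =>
    sub_mem (hDF i x hx) (F_le (Nat.le_succ i) (raises_rightMul m hl i x hx))
  rw [← rightMul_apply, ← sub_eq_zero, ← LinearMap.sub_apply]
  refine IsSeriesSum.unique 𝔭 h1 fun i => ⟨i + 1, fun N hN => ?_⟩
  obtain ⟨N, rfl⟩ : ∃ N', N = N' + 1 := ⟨N - 1, by omega⟩
  -- The telescoping term `{a; c, …, c, l}`: modulo the recursion for braces, `D - R_l` sends the
  -- `n`-th summand to `w (n-1) / (n-1)! - w n / n!`, with no first term when `n = 0`.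
  set w : ℕ → A m := fun n => 𝔭.brace (n + 1) a
    (Fin.snoc (α := fun _ => A 0) (fun _ => c) l) with hw
  have hstep : ∀ n, (D m - 𝔭.rightMul m l) (𝔭.brace n a fun _ => c)
      = slotSum (fun _ => l) (𝔭.brace n a) (fun _ => c) - w n := by
    intro n
    rw [LinearMap.sub_apply, 𝔭.derivation_brace hD ha]
    have e1 : slotSum (D 0) (𝔭.brace n a) (fun _ => c)
        = slotSum (fun x => l + 𝔭.star (add_zero 0) x l) (𝔭.brace n a) (fun _ => c) := by
      simp only [slotSum, hc]
    rw [e1, slotSum_add (𝔭.brace_update_add n _), hw]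
    simp only [brace_snoc, rightMul_apply]
    abel
  have hsum : ∀ N, ∑ n ∈ Finset.range (N + 1),
      (D m - 𝔭.rightMul m l) (invFact k n • 𝔭.brace n a fun _ => c) = -(invFact k N • w N) := by
    intro N
    simp only [map_smul, hstep]
    induction N with
    | zero => simp [slotSum]
    | succ N ih =>
      rw [Finset.sum_range_succ, ih, slotSum_const_brace, smul_sub,
        ← Nat.cast_smul_eq_nsmul k, smul_smul, invFact_succ_mul]
      abel
  have hwmem : w N ∈ 𝔭.F i m := by
    have := 𝔭.brace_mem (N + 1) 0 a (Fin.snoc (α := fun _ => A 0) (fun _ => c) l) (fun _ => 1)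
      (mem_F_zero _) fun j => by
        cases j using Fin.lastCases with
        | last => simpa using hl
        | cast j => simpa using hcmem
    exact F_le (by simp; omega) this
  rw [sub_zero]
  exact (hsum N).symm ▸ neg_mem (Submodule.smul_mem _ _ hwmem)

/-- `a ⊚ (e^{R_l} (1 + b)) = e^{R_l} (a ⊚ (1 + b))`. -/
theorem circOneAdd_expSubOne_add {m : ℤ} (a : A m) {l b : A 0} (hl : l ∈ 𝔭.F 1 0)
    (hb : b ∈ 𝔭.F 1 0) :
    𝔭.circOneAdd a (𝔭.expSubOne l + 𝔭.expOp (𝔭.rightMul 0 l) b)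
      = 𝔭.expOp (𝔭.rightMul m l) (𝔭.circOneAdd a b) := by
  have hcmem := expCurve_mem hl hb
  set P := 𝔭.seqAlgebra.circOneAdd (𝔭.seqConst a) (𝔭.expCurve l b hl) with hP
  have h0 : P.1 0 = 𝔭.circOneAdd a b := 𝔭.seqEvalZero.map_circOneAdd (𝔭.seqConst a) hcmem
  have h1 : 𝔭.seqEval.toFun m P = 𝔭.circOneAdd a
      (𝔭.expSubOne l + 𝔭.expOp (𝔭.rightMul 0 l) b) := by
    rw [hP, 𝔭.seqEval.map_circOneAdd _ hcmem, seqEval_seqConst, seqEval_expCurve]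
  -- The differential equation `P' = P ⋆ l` read on coefficients; multiplying by the constant series
  -- `l` acts coefficientwise.
  have hder : ∀ j, P.1 (j + 1) = 𝔭.rightMul m l (P.1 j) := by
    intro j
    have := derivation_circOneAdd 𝔭.seqDeriv_star (fun i => 𝔭.seqDeriv_mem i m)
      (𝔭.seqDeriv_seqConst a) (seqConst_mem hl) hcmem (seqDeriv_expCurve b hl)
    exact (congrArg (fun x => x.1 j) this).trans (𝔭.seqStar_seqConst _ l j _)
  have hiter : ∀ j, P.1 j = (𝔭.rightMul m l)^[j] (𝔭.circOneAdd a b) := by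
    intro j
    induction j with
    | zero => exact h0
    | succ j ih => rw [hder, ih, Function.iterate_succ_apply']
  rw [← h1]
  change 𝔭.seriesSum _ = 𝔭.seriesSum _
  simp only [hiter]

end SeqAlgebra

/-! ### Pre-Lie exponential, circle product and gauge identities -/

section Exponential

variable {k : Type u} [CommRing k] {A : ℤ → Type v}
  [∀ n, AddCommGroup (A n)] [∀ n, Module k (A n)] {𝔭 : CompleteDGPreLie k A} [Algebra ℚ k]

theorem Raises.expOp_add {m : ℤ} {f : A m →ₗ[k] A m} (hf : 𝔭.Raises f) (x y : A m) :
    𝔭.expOp f (x + y) = 𝔭.expOp f x + 𝔭.expOp f y := by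
  refine IsSeriesSum.seriesSum_eq ?_
  simpa [iterate_map_add] using (hf.isSeriesSum_expOp x).add (hf.isSeriesSum_expOp y)

theorem Raises.expOp_injective {m : ℤ} {f : A m →ₗ[k] A m} (hf : 𝔭.Raises f) :
    Function.Injective (𝔭.expOp f) :=
  Function.LeftInverse.injective hf.expOp_neg_expOp

theorem Raises.expOp_sub_mem {m : ℤ} {f : A m →ₗ[k] A m} (hf : 𝔭.Raises f) (x : A m) :
    𝔭.expOp f x - x ∈ 𝔭.F 1 m := by
  refine sub_mem_symm ?_
  simpa using (hf.isSeriesSum_expOp x).partial_sub_mem 1 1 fun j hj =>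
    Submodule.smul_mem _ _ (F_le (by omega) (hf.iterate_mem (mem_F_zero x) j))

theorem expSubOne_mem {l : A 0} (hl : l ∈ 𝔭.F 1 0) : 𝔭.expSubOne l ∈ 𝔭.F 1 0 :=
  (𝔭.isSeriesSum_expSubOne l hl).mem 1 fun j =>
    Submodule.smul_mem _ _ (F_le (by omega) (𝔭.pow_mem l hl j))

theorem expSubOne_zero : 𝔭.expSubOne 0 = 0 := by
  have hp : ∀ n, 𝔭.pow 0 n = 0 := fun n => by cases n <;> simp [pow]
  have := IsSeriesSum.of_eq_zero (𝔭 := 𝔭)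
    (x := fun n => algebraMap ℚ k (1 / ((n + 1).factorial : ℚ)) • 𝔭.pow 0 n)
    (fun j => by simp [hp])
  rw [hp, smul_zero] at this
  exact this.seriesSum_eq

theorem circOneAdd_zero {m : ℤ} (a : A m) : 𝔭.circOneAdd a 0 = a := by
  -- As `0` lies in every `F_i`, so does the brace, and separatedness finishes.
  have hb : ∀ n, 𝔭.brace (n + 1) a (fun _ => 0) = 0 := fun n =>
    𝔭.separated m _ fun i => F_le (by simp; nlinarith)
      (𝔭.brace_mem (n + 1) 0 a (fun _ => 0) (fun _ => i) (mem_F_zero a) fun _ => zero_mem _)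
  have := IsSeriesSum.of_eq_zero (𝔭 := 𝔭)
    (x := fun n => invFact k n • 𝔭.brace n a fun _ => 0)
    (fun j => by simp [hb])
  rw [invFact_zero, one_smul, brace_zero] at this
  exact this.seriesSum_eq

/-- `a ⊚ e^l = e^{R_l} a`. -/
theorem circOneAdd_expSubOne {m : ℤ} (a : A m) {l : A 0} (hl : l ∈ 𝔭.F 1 0) :
    𝔭.circOneAdd a (𝔭.expSubOne l) = 𝔭.expOp (𝔭.rightMul m l) a := by
  have := circOneAdd_expSubOne_add a hl (zero_mem _)
  rwa [expOp_zero_right, add_zero, circOneAdd_zero] at this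

/-- `e^{ad_l} x = (e^l ⋆ x) ⊚ e^{-l}`. -/
theorem expAd_eq_circOneAdd {m : ℤ} (x : A m) {l : A 0} (hl : l ∈ 𝔭.F 1 0) :
    𝔭.expAd l x
      = 𝔭.circOneAdd (𝔭.oneAddStar (𝔭.expSubOne l) x) (𝔭.expSubOne (-l)) := by
  rw [circOneAdd_expSubOne _ (neg_mem hl), ← expOp_rightMul_expAd x hl, rightMul_neg,
    (raises_rightMul m hl).expOp_neg_expOp]

/-- If `e^r = e^l ⊚ e^l'`, then `e^{ad_l} e^{ad_l'} = e^{ad_r}`. -/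
theorem expAd_expAd {m : ℤ} (x : A m) {l l' r : A 0} (hl : l ∈ 𝔭.F 1 0) (hl' : l' ∈ 𝔭.F 1 0)
    (hr : r ∈ 𝔭.F 1 0)
    (h : 𝔭.expSubOne r = 𝔭.expSubOne l' + 𝔭.expOp (𝔭.rightMul 0 l') (𝔭.expSubOne l)) :
    𝔭.expAd l (𝔭.expAd l' x) = 𝔭.expAd r x := by
  -- After `e^{R_r}` the right side is `e^r ⋆ x`. On the left, `h` and the flow theorem give
  -- `e^{R_r} = e^{R_l'} e^{R_l}`; here `e^{R_l} e^{ad_l}` becomes `e^l ⋆`, and then `e^{R_l'}` of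
  -- the product cancels `e^{ad_l'}`.
  refine (raises_rightMul m hr).expOp_injective ?_
  rw [expOp_rightMul_expAd x hr, ← circOneAdd_expSubOne _ hr, h,
    circOneAdd_expSubOne_add _ hl' (expSubOne_mem hl), circOneAdd_expSubOne _ hl,
    expOp_rightMul_expAd _ hl, oneAddStar, (raises_rightMul m hl').expOp_add,
    expOp_rightMul_expAd _ hl', expOp_rightMul_star _ _ _ hl', expAd_eq,
    (raises_adHom m hl').expOp_neg_expOp, oneAddStar, oneAddStar, map_add, LinearMap.add_apply,
    add_assoc]

/-- The gauge action preserves the equation `α ⋆ α = 0`. -/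
theorem expAd_star_expAd {x : A (-1)} {l : A 0} (hl : l ∈ 𝔭.F 1 0)
    (hx : 𝔭.star (show (-1 : ℤ) + -1 = -2 by norm_num) x x = 0) :
    𝔭.star (show (-1 : ℤ) + -1 = -2 by norm_num) (𝔭.expAd l x) (𝔭.expAd l x) = 0 := by
  -- After `e^{R_l}` the product becomes `(e^l ⋆ x) ⋆ x`. Since `x` is odd and `x ⋆ x = 0`, right
  -- symmetry makes `(u ⋆ x) ⋆ x` equal to its own negative.
  refine (raises_rightMul (-2) hl).expOp_injective ?_
  rw [expOp_zero_right, expOp_rightMul_star _ _ _ hl, expOp_rightMul_expAd _ hl, expAd_eq,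
    (raises_adHom (-1) hl).expOp_neg_expOp, oneAddStar, map_add, LinearMap.add_apply, hx, zero_add]
  have h := 𝔭.right_symm (zero_add (-1)) (zero_add (-1)) (show (-1 : ℤ) + -1 = -2 by norm_num)
    (show (0 : ℤ) + -1 + -1 = -2 by norm_num) (𝔭.expSubOne l) x x
  rw [hx, map_zero, sub_zero] at h
  exact eq_zero_of_eq_neg k (by simpa using h)

/-- The nonlinear part of the pre-Lie exponential is a contraction. -/
theorem expSubOne_sub_self_sub_mem {l l' : A 0} (hl : l ∈ 𝔭.F 1 0) (hl' : l' ∈ 𝔭.F 1 0) {i : ℕ}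
    (h : l - l' ∈ 𝔭.F i 0) :
    (𝔭.expSubOne l - l) - (𝔭.expSubOne l' - l') ∈ 𝔭.F (i + 1) 0 := by
  have hS := (𝔭.isSeriesSum_expSubOne l hl).sub (𝔭.isSeriesSum_expSubOne l' hl')
  -- Cutting after one term removes the linear part; the remaining powers gain at least one
  -- filtration step.
  have := hS.partial_sub_mem 1 (i + 1) fun j hj => by
    rw [← smul_sub]
    exact Submodule.smul_mem _ _ (F_le (by omega) (pow_sub_mem hl hl' h j))
  have := neg_mem this
  simp only [Finset.sum_range_one, pow, zero_add, Nat.factorial_one, Nat.cast_one, div_one,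
    map_one, one_smul] at this
  convert this using 1
  abel

theorem expSubOne_injOn : Set.InjOn 𝔭.expSubOne {l | l ∈ 𝔭.F 1 0} := by
  intro l hl l' hl' h
  refine eq_of_forall_sub_mem (𝔭 := 𝔭) fun i => ?_
  induction i with
  | zero => exact mem_F_zero _
  | succ i ih =>
    have := neg_mem (expSubOne_sub_self_sub_mem hl hl' ih)
    rw [h] at this
    simpa using this

/-- Solving `e^l - 1 = b` is a fixed-point problem for the contraction `T l = b - (e^l - 1 - l)`;
its iterates from `0` converge by completeness. -/
theorem expSubOne_surjOn : Set.SurjOn 𝔭.expSubOne {l | l ∈ 𝔭.F 1 0} {l | l ∈ 𝔭.F 1 0} := by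
  intro b hb
  set T : A 0 → A 0 := fun l => b - (𝔭.expSubOne l - l) with hT
  have hTmem : ∀ l ∈ 𝔭.F 1 0, T l ∈ 𝔭.F 1 0 := fun l hl =>
    sub_mem hb (sub_mem (expSubOne_mem hl) hl)
  have hTsub : ∀ {l l' : A 0} {i : ℕ}, l ∈ 𝔭.F 1 0 → l' ∈ 𝔭.F 1 0 → l - l' ∈ 𝔭.F i 0 →
      T l - T l' ∈ 𝔭.F (i + 1) 0 := fun hl hl' h => by
    have := neg_mem (expSubOne_sub_self_sub_mem hl hl' h)
    convert this using 1
    simp only [hT]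
    abel
  have hmem : ∀ n, T^[n] 0 ∈ 𝔭.F 1 0 := fun n => by
    induction n with
    | zero => exact zero_mem _
    | succ n ih => rw [Function.iterate_succ_apply']; exact hTmem _ ih
  have hcauchy : ∀ n, T^[n + 1] 0 - T^[n] 0 ∈ 𝔭.F n 0 := fun n => by
    induction n with
    | zero => exact mem_F_zero _
    | succ n ih =>
      have := hTsub (hmem (n + 1)) (hmem n) ih
      rwa [← Function.iterate_succ_apply' T, ← Function.iterate_succ_apply' T] at this
  obtain ⟨l, hl⟩ := 𝔭.complete 0 (fun n => T^[n] 0) hcauchy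
  have hl1 : l ∈ 𝔭.F 1 0 := by simpa using add_mem (hl 1) (hmem 1)
  have hfix : l = T l := by
    refine eq_of_forall_sub_mem (𝔭 := 𝔭) fun i => ?_
    have h1 := F_le (Nat.le_succ i) (hl (i + 1))
    rw [Function.iterate_succ_apply'] at h1
    exact sub_mem_trans h1 (sub_mem_symm (F_le (Nat.le_succ i) (hTsub hl1 (hmem i) (hl i))))
  refine ⟨l, hl1, ?_⟩
  simp only [hT] at hfix
  rw [eq_sub_iff_add_eq, add_sub_cancel] at hfix
  exact hfix

theorem Hom.map_expOp_rightMul {B : ℤ → Type w} [∀ n, AddCommGroup (B n)]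
    [∀ n, Module k (B n)] {𝔮 : CompleteDGPreLie k B} (φ : Hom 𝔭 𝔮) {m : ℤ} {l : A 0}
    (hl : l ∈ 𝔭.F 1 0) (x : A m) :
    φ.toFun m (𝔭.expOp (𝔭.rightMul m l) x)
      = 𝔮.expOp (𝔮.rightMul m (φ.toFun 0 l)) (φ.toFun m x) := by
  have hiter : ∀ n, φ.toFun m ((𝔭.rightMul m l)^[n] x)
      = (𝔮.rightMul m (φ.toFun 0 l))^[n] (φ.toFun m x) := fun n => by
    induction n with
    | zero => rfl
    | succ n ih =>
      rw [Function.iterate_succ_apply', Function.iterate_succ_apply', ← ih, rightMul_apply,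
        φ.map_star, rightMul_apply]
  refine (IsSeriesSum.seriesSum_eq (𝔭 := 𝔮) ?_).symm
  simpa only [map_smul, hiter] using ((raises_rightMul m hl).isSeriesSum_expOp x).map (𝔮 := 𝔮)
    (φ.toFun m) fun i => φ.map_mem i m

end Exponential

/-! ### The extension by `δ` and gauge transformations -/

section Incl

variable {k : Type u} [CommRing k] {A : ℤ → Type v} [∀ n, AddCommGroup (A n)]

theorem incl_sub {n : ℤ} (a b : A n) : incl k (a - b) = incl k a - incl k b := by
  simp [incl]

theorem incl_neg {n : ℤ} (a : A n) : incl k (-a) = -incl k a := by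
  simp [incl]

theorem delta_add_incl_injective :
    Function.Injective fun a : A (-1) => delta k A + incl k a := by
  intro a b h
  simpa [incl] using h

end Incl

section ExtensionHom

variable {k : Type u} [CommRing k] {A : ℤ → Type v}
  [∀ n, AddCommGroup (A n)] [∀ n, Module k (A n)] (𝔭 : CompleteDGPreLie k A)

/-- The inclusion of `A` in `A ⊕ k δ`, as a morphism. -/
def inclHom : Hom 𝔭 𝔭.extension where
  toFun n := LinearMap.inl k (A n) (Delta k n)
  map_mem _ _ _ ha := ⟨ha, zero_mem _⟩
  map_star h a b := by
    refine Prod.ext ?_ rfl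
    simp [extension, starDelta]

theorem inclHom_toFun {n : ℤ} (a : A n) : 𝔭.inclHom.toFun n a = incl k a := rfl

theorem incl_mem {i : ℕ} {n : ℤ} {a : A n} (ha : a ∈ 𝔭.F i n) :
    incl k a ∈ 𝔭.extension.F i n := 𝔭.inclHom.map_mem i n a ha

theorem fst_mem {i : ℕ} {n : ℤ} {x : Ext k A n} (hx : x ∈ 𝔭.extension.F i n) :
    x.1 ∈ 𝔭.F i n := hx.1

/-- The Maurer–Cartan equation in `A ⊕ k δ`. -/
theorem extension_star_self_eq_zero_iff (a : A (-1)) :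
    𝔭.extension.star (show (-1 : ℤ) + -1 = -2 by norm_num) (delta k A + incl k a)
        (delta k A + incl k a) = 0
      ↔ 𝔭.d (show (-2 : ℤ) + 1 = -1 by norm_num) a
        + 𝔭.star (show (-1 : ℤ) + -1 = -2 by norm_num) a a = 0 := by
  rw [Prod.ext_iff]
  simp [extension, delta, incl, starDelta, add_comm]

/-- The projection `A_{-1} ⊕ k δ → A_{-1}` which sends `δ` to a given element. -/
def substDelta (δ : A (-1)) : Ext k A (-1) →ₗ[k] A (-1) :=
  LinearMap.coprod LinearMap.id
    ((LinearMap.toSpanSingleton k (A (-1)) δ).comp (Submodule.subtype _))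

theorem substDelta_apply (δ : A (-1)) (x : Ext k A (-1)) :
    substDelta δ x = x.1 + (x.2 : k) • δ := rfl

theorem substDelta_delta_add_incl (δ a : A (-1)) :
    substDelta δ (delta k A + incl k a) = δ + a := by
  simp [substDelta_apply, delta, incl, add_comm]

theorem substDelta_mem (δ : A (-1)) (i : ℕ) (x : Ext k A (-1))
    (hx : x ∈ 𝔭.extension.F i (-1)) : substDelta δ x ∈ 𝔭.F i (-1) := by
  rw [substDelta_apply]
  cases i with
  | zero => exact mem_F_zero _
  | succ i =>
    have h2 : x.2 = 0 := by simpa using hx.2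
    simpa [h2] using hx.1

/-- Both `ad_l` of the formal `δ` and of its replacement are `-d l`. The substitution need not
respect products, since `δ ⋆ a = 0` may fail in `A`; intertwining `ad_l` is enough. -/
theorem substDelta_ad {δ : A (-1)} {l : A 0}
    (hδ : 𝔭.d (show (-1 : ℤ) + 1 = 0 by norm_num) l
      = 𝔭.bracket (show (-1 : ℤ) + 0 = -1 by norm_num) δ l) (x : Ext k A (-1)) :
    substDelta δ (𝔭.extension.ad (incl k l) x) = 𝔭.ad l (substDelta δ x) := by
  rw [ad_eq, ad_eq, substDelta_apply, substDelta_apply]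
  simp [extension, incl, starDelta, hδ, bracket, smul_sub]
  abel

variable {𝔭} [Algebra ℚ k]

theorem substDelta_expAd {δ : A (-1)} {l : A 0} (hl : l ∈ 𝔭.F 1 0)
    (hδ : 𝔭.d (show (-1 : ℤ) + 1 = 0 by norm_num) l
      = 𝔭.bracket (show (-1 : ℤ) + 0 = -1 by norm_num) δ l) (x : Ext k A (-1)) :
    substDelta δ (𝔭.extension.expAd (incl k l) x) = 𝔭.expAd l (substDelta δ x) := by
  have hiter : ∀ n, substDelta δ ((𝔭.extension.ad (incl k l))^[n] x)
      = (𝔭.ad l)^[n] (substDelta δ x) := fun n => by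
    induction n with
    | zero => rfl
    | succ n ih =>
      rw [Function.iterate_succ_apply', Function.iterate_succ_apply', ← ih, substDelta_ad _ hδ]
  refine (IsSeriesSum.seriesSum_eq (𝔭 := 𝔭) ?_).symm
  simpa only [map_smul, hiter] using
    (𝔭.extension.isSeriesSum_expAd (incl k l) (𝔭.incl_mem hl) x).map (𝔮 := 𝔭) (substDelta δ)
    fun i y hy => 𝔭.substDelta_mem δ i y hy

/-- The gauge transformation of `a` by `l`, defined by `e^{ad_l} (δ + a) = δ + gaugeTransform l a`. -/
noncomputable def gaugeTransform (𝔭 : CompleteDGPreLie k A) (l : A 0) (a : A (-1)) : A (-1) :=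
  (𝔭.extension.expAd (incl k l) (delta k A + incl k a)).1

/-- The coefficient of `δ` stays `1`, because `e^{ad_l}` changes its argument by an element of
`F_1`, which has no `δ` component. -/
theorem delta_add_incl_gaugeTransform {l : A 0} (hl : l ∈ 𝔭.F 1 0) (a : A (-1)) :
    delta k A + incl k (𝔭.gaugeTransform l a)
      = 𝔭.extension.expAd (incl k l) (delta k A + incl k a) := by
  have h := (raises_adHom (-1) (𝔭.incl_mem hl)).expOp_sub_mem (delta k A + incl k a)
  rw [← expAd_eq] at h
  have h2 := h.2
  simp only [one_ne_zero, if_false, SetLike.mem_coe, Submodule.mem_bot, Prod.snd_sub,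
    sub_eq_zero] at h2
  refine Prod.ext ?_ ?_
  · simp [gaugeTransform, delta, incl]
  · rw [h2]
    simp [incl]

theorem delta_add_incl_gaugeTransform_eq_circOneAdd {l : A 0} (hl : l ∈ 𝔭.F 1 0) (a : A (-1)) :
    delta k A + incl k (𝔭.gaugeTransform l a)
      = 𝔭.extension.circOneAdd (𝔭.extension.oneAddStar (incl k (𝔭.expSubOne l))
          (delta k A + incl k a)) (incl k (𝔭.expSubOne (-l))) := by
  rw [delta_add_incl_gaugeTransform hl, expAd_eq_circOneAdd _ (𝔭.incl_mem hl), ← incl_neg,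
    ← inclHom_toFun 𝔭 l, ← inclHom_toFun 𝔭 (-l), ← 𝔭.inclHom.map_expSubOne hl,
    ← 𝔭.inclHom.map_expSubOne (neg_mem hl), inclHom_toFun, inclHom_toFun]

theorem gaugeTransform_gaugeTransform (a : A (-1)) {l l' r : A 0} (hl : l ∈ 𝔭.F 1 0) (hl' : l' ∈ 𝔭.F 1 0)
    (hr : r ∈ 𝔭.F 1 0)
    (h : 𝔭.expSubOne r = 𝔭.expSubOne l' + 𝔭.expOp (𝔭.rightMul 0 l') (𝔭.expSubOne l)) :
    𝔭.gaugeTransform l (𝔭.gaugeTransform l' a) = 𝔭.gaugeTransform r a := by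
  apply delta_add_incl_injective (k := k)
  simp only [delta_add_incl_gaugeTransform, hl, hl', hr]
  refine expAd_expAd _ (𝔭.incl_mem hl) (𝔭.incl_mem hl') (𝔭.incl_mem hr) ?_
  simp only [← inclHom_toFun 𝔭]
  rw [← 𝔭.inclHom.map_expSubOne hl, ← 𝔭.inclHom.map_expSubOne hl', ← 𝔭.inclHom.map_expSubOne hr,
    ← 𝔭.inclHom.map_expOp_rightMul hl', h, map_add]

theorem gaugeTransform_zero (a : A (-1)) : 𝔭.gaugeTransform 0 a = a := by
  have h := 𝔭.extension.expAd_eq (incl k (0 : A 0)) (delta k A + incl k a)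
  have h0 : 𝔭.extension.adHom (-1) (incl k (0 : A 0)) = 0 := by
    have : incl k (0 : A 0) = 0 := rfl
    ext x <;> simp [adHom_apply, this]
  rw [h0, expOp_zero_left] at h
  rw [gaugeTransform, h]
  simp [delta, incl]

theorem gaugeTransform_maurerCartan {l : A 0} (hl : l ∈ 𝔭.F 1 0) {a : A (-1)}
    (ha : 𝔭.d (show (-2 : ℤ) + 1 = -1 by norm_num) a
      + 𝔭.star (show (-1 : ℤ) + -1 = -2 by norm_num) a a = 0) :
    𝔭.d (show (-2 : ℤ) + 1 = -1 by norm_num) (𝔭.gaugeTransform l a)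
      + 𝔭.star (show (-1 : ℤ) + -1 = -2 by norm_num) (𝔭.gaugeTransform l a) (𝔭.gaugeTransform l a) = 0 := by
  rw [← extension_star_self_eq_zero_iff] at ha ⊢
  rw [delta_add_incl_gaugeTransform hl]
  exact expAd_star_expAd (𝔭.incl_mem hl) ha

/-- The formula `(e^l ⋆ α) ⊚ e^{-l}` involves `l` only through `e^l` and `e^{-l}`, so continuity of
the logarithm is not needed. -/
theorem gaugeTransform_sub_mem {l l' : A 0} (hl : l ∈ 𝔭.F 1 0) (hl' : l' ∈ 𝔭.F 1 0) {a a' : A (-1)}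
    {i : ℕ} (h : 𝔭.expSubOne l - 𝔭.expSubOne l' ∈ 𝔭.F i 0)
    (hneg : 𝔭.expSubOne (-l) - 𝔭.expSubOne (-l') ∈ 𝔭.F i 0) (ha : a - a' ∈ 𝔭.F i (-1)) :
    𝔭.gaugeTransform l a - 𝔭.gaugeTransform l' a' ∈ 𝔭.F i (-1) := by
  have haa : (delta k A + incl k a) - (delta k A + incl k a') ∈ 𝔭.extension.F i (-1) := by
    rw [add_sub_add_left_eq_sub, ← incl_sub]
    exact 𝔭.incl_mem ha
  have hstar : 𝔭.extension.oneAddStar (incl k (𝔭.expSubOne l)) (delta k A + incl k a)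
      - 𝔭.extension.oneAddStar (incl k (𝔭.expSubOne l')) (delta k A + incl k a')
      ∈ 𝔭.extension.F i (-1) := by
    have h1 := 𝔭.extension.star_mem (zero_add (-1)) i 0 _ (delta k A + incl k a)
      (𝔭.incl_mem h) (mem_F_zero _)
    have h2 := 𝔭.extension.star_mem (zero_add (-1)) 0 i (incl k (𝔭.expSubOne l')) _
      (mem_F_zero _) haa
    rw [incl_sub, map_sub, LinearMap.sub_apply, add_zero] at h1
    rw [map_sub, zero_add] at h2
    rw [oneAddStar, oneAddStar, add_sub_add_comm]
    exact add_mem haa (sub_mem_trans h1 h2)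
  have key := circOneAdd_sub_mem (𝔭.incl_mem (expSubOne_mem (neg_mem hl)))
    (𝔭.incl_mem (expSubOne_mem (neg_mem hl'))) hstar
    (by rw [← incl_sub]; exact 𝔭.incl_mem hneg)
  rw [← delta_add_incl_gaugeTransform_eq_circOneAdd hl, ← delta_add_incl_gaugeTransform_eq_circOneAdd hl',
    add_sub_add_left_eq_sub, ← incl_sub] at key
  exact 𝔭.fst_mem key

end ExtensionHom

end CompleteDGPreLie

namespace CompleteLeftUnitalDGPreLie

open CompleteDGPreLie

/-! ### The gauge group, its topology and its action -/

section GaugeGroup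

variable {k : Type u} [CommRing k] {A : ℤ → Type v}
  [∀ n, AddCommGroup (A n)] [∀ n, Module k (A n)] {𝔞 : CompleteLeftUnitalDGPreLie k A}

section Topology

theorem isOpen_groupLike_ball (g : 𝔞.GroupLike) (i : ℕ) :
    IsOpen {h : 𝔞.GroupLike | h.1 - g.1 ∈ 𝔞.F i 0} :=
  isOpen_induced (t := 𝔞.topology 0) (TopologicalSpace.isOpen_generateFrom_of_mem ⟨g.1, i, rfl⟩)

theorem isOpen_mc_ball (a : 𝔞.MC) (i : ℕ) :
    IsOpen {b : 𝔞.MC | b.1 - a.1 ∈ 𝔞.F i (-1)} :=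
  isOpen_induced (t := 𝔞.topology (-1))
    (TopologicalSpace.isOpen_generateFrom_of_mem ⟨a.1, i, rfl⟩)

theorem continuous_groupLike_iff {X : Type*} [TopologicalSpace X] {f : X → 𝔞.GroupLike} :
    Continuous f ↔ ∀ (y : A 0) (i : ℕ), IsOpen {x | (f x).1 - y ∈ 𝔞.F i 0} := by
  refine continuous_induced_rng.trans (continuous_generateFrom_iff.trans ?_)
  exact ⟨fun h y i => h _ ⟨y, i, rfl⟩, by rintro h _ ⟨y, i, rfl⟩; exact h y i⟩

theorem continuous_mc_iff {X : Type*} [TopologicalSpace X] {f : X → 𝔞.MC} :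
    Continuous f ↔ ∀ (y : A (-1)) (i : ℕ), IsOpen {x | (f x).1 - y ∈ 𝔞.F i (-1)} := by
  refine continuous_induced_rng.trans (continuous_generateFrom_iff.trans ?_)
  exact ⟨fun h y i => h _ ⟨y, i, rfl⟩, by rintro h _ ⟨y, i, rfl⟩; exact h y i⟩

theorem mem_groupLike_ball (g : 𝔞.GroupLike) (i : ℕ) :
    g ∈ {h : 𝔞.GroupLike | h.1 - g.1 ∈ 𝔞.F i 0} := by
  change g.1 - g.1 ∈ 𝔞.F i 0
  rw [sub_self]
  exact zero_mem _

theorem mem_mc_ball (a : 𝔞.MC) (i : ℕ) : a ∈ {b : 𝔞.MC | b.1 - a.1 ∈ 𝔞.F i (-1)} := by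
  change a.1 - a.1 ∈ 𝔞.F i (-1)
  rw [sub_self]
  exact zero_mem _

end Topology

/-- The unit of the gauge group. -/
@[reducible] def groupLikeOne : One 𝔞.GroupLike := ⟨⟨𝔞.one, by simp⟩⟩

attribute [local instance] groupLikeOne

theorem coe_one : (1 : 𝔞.GroupLike).1 = 𝔞.one := rfl

variable [Algebra ℚ k]

theorem exp_sub_one (l : A 0) : 𝔞.exp l - 𝔞.one = 𝔞.expSubOne l := by
  simp [exp]

theorem exp_bijOn : Set.BijOn 𝔞.exp {l | l ∈ 𝔞.F 1 0} {g | g - 𝔞.one ∈ 𝔞.F 1 0} := by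
  refine ⟨fun l hl => ?_, fun l hl l' hl' h => expSubOne_injOn hl hl' ?_, fun g hg => ?_⟩
  · simpa only [Set.mem_ofPred_eq, exp_sub_one] using expSubOne_mem hl
  · rw [← exp_sub_one, ← exp_sub_one, h]
  · obtain ⟨l, hl, h⟩ := expSubOne_surjOn (𝔭 := 𝔞.toCompleteDGPreLie) hg
    exact ⟨l, hl, by rw [exp, h, add_sub_cancel]⟩

theorem expOp_rightMul_one {l : A 0} (hl : l ∈ 𝔞.F 1 0) :
    𝔞.expOp (𝔞.rightMul 0 l) 𝔞.one = 𝔞.exp l := by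
  have hiter : ∀ n, (𝔞.rightMul 0 l)^[n + 1] 𝔞.one = 𝔞.pow l n := fun n => by
    induction n with
    | zero => exact 𝔞.one_star l
    | succ n ih => rw [Function.iterate_succ_apply', ih]; rfl
  refine IsSeriesSum.seriesSum_eq ?_
  have := IsSeriesSum.cons (𝔭 := 𝔞.toCompleteDGPreLie)
    (x := fun n => invFact k n • (𝔞.rightMul 0 l)^[n] 𝔞.one) (s := 𝔞.expSubOne l) (by
      simp only [hiter]
      exact 𝔞.isSeriesSum_expSubOne l hl)
  simpa [exp] using this

theorem circ_exp {m : ℤ} (a : A m) {l : A 0} (hl : l ∈ 𝔞.F 1 0) :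
    𝔞.circ a (𝔞.exp l) = 𝔞.expOp (𝔞.rightMul m l) a := by
  rw [circ, exp_sub_one, circOneAdd_expSubOne _ hl]

/-- Splitting `g = 1 + (g - 1)` puts `g ⊚ e^l` in the form `e^{R_l} (1 + b)` required by the flow
theorem; associativity and the action law both rest on this. -/
theorem circ_sub_one {g l : A 0} (hl : l ∈ 𝔞.F 1 0) :
    𝔞.circ g (𝔞.exp l) - 𝔞.one
      = 𝔞.expSubOne l + 𝔞.expOp (𝔞.rightMul 0 l) (g - 𝔞.one) := by
  rw [circ_exp _ hl]
  conv_lhs => rw [← add_sub_cancel 𝔞.one g]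
  rw [(raises_rightMul 0 hl).expOp_add, expOp_rightMul_one hl, exp]
  abel

theorem circ_circ {m : ℤ} (a : A m) {g h : A 0} (hg : g - 𝔞.one ∈ 𝔞.F 1 0)
    (hh : h - 𝔞.one ∈ 𝔞.F 1 0) : 𝔞.circ (𝔞.circ a g) h = 𝔞.circ a (𝔞.circ g h) := by
  obtain ⟨l, hl, rfl⟩ := exp_bijOn.surjOn hh
  rw [circ_exp _ hl, circ, circ, circ_sub_one hl, circOneAdd_expSubOne_add _ hl hg]

theorem circ_mem {g h : A 0} (hg : g - 𝔞.one ∈ 𝔞.F 1 0) (hh : h - 𝔞.one ∈ 𝔞.F 1 0) :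
    𝔞.circ g h - 𝔞.one ∈ 𝔞.F 1 0 := by
  obtain ⟨l, hl, rfl⟩ := exp_bijOn.surjOn hh
  rw [circ_sub_one hl]
  exact add_mem (expSubOne_mem hl) ((raises_rightMul 0 hl).expOp_mem hg)

/-- The inverse of the pre-Lie exponential. -/
noncomputable def log (g : 𝔞.GroupLike) : A 0 := (exp_bijOn.surjOn g.2).choose

theorem log_mem (g : 𝔞.GroupLike) : log g ∈ 𝔞.F 1 0 := (exp_bijOn.surjOn g.2).choose_spec.1

theorem exp_log (g : 𝔞.GroupLike) : 𝔞.exp (log g) = g.1 :=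
  (exp_bijOn.surjOn g.2).choose_spec.2

theorem log_eq {g : 𝔞.GroupLike} {l : A 0} (hl : l ∈ 𝔞.F 1 0) (h : g.1 = 𝔞.exp l) :
    log g = l :=
  exp_bijOn.injOn (log_mem g) hl ((exp_log g).trans h)

theorem expSubOne_log (g : 𝔞.GroupLike) : 𝔞.expSubOne (log g) = g.1 - 𝔞.one := by
  rw [← exp_sub_one, exp_log]

/-- The circle product on group-like elements. -/
@[reducible] noncomputable def groupLikeMul : Mul 𝔞.GroupLike :=
  ⟨fun g h => ⟨𝔞.circ g.1 h.1, circ_mem g.2 h.2⟩⟩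

/-- The inverse `e^l ↦ e^{-l}` on group-like elements. -/
@[reducible] noncomputable def groupLikeInv : Inv 𝔞.GroupLike :=
  ⟨fun g => ⟨𝔞.exp (-log g), exp_bijOn.mapsTo (neg_mem (log_mem g))⟩⟩

attribute [local instance] groupLikeMul groupLikeInv

theorem coe_mul (g h : 𝔞.GroupLike) : (g * h).1 = 𝔞.circ g.1 h.1 := rfl

theorem coe_inv (g : 𝔞.GroupLike) : (g⁻¹).1 = 𝔞.exp (-log g) := rfl

/-- The gauge group `(1 + F_1 A_0, ⊚, 1)`. -/
@[reducible] noncomputable def gaugeGroup : Group 𝔞.GroupLike :=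
  Group.ofLeftAxioms (fun f g h => Subtype.ext (circ_circ f.1 g.2 h.2))
    (fun g => Subtype.ext (by
      rw [coe_mul, coe_one, ← exp_log g, circ_exp _ (log_mem g), expOp_rightMul_one (log_mem g)]))
    (fun g => Subtype.ext (by
      have h := log_mem g
      rw [coe_mul, coe_one, coe_inv, ← exp_log g, circ_exp _ h, log_eq h (exp_log g).symm,
        ← expOp_rightMul_one (neg_mem h), rightMul_neg, (raises_rightMul 0 h).expOp_expOp_neg]))

attribute [local instance] gaugeGroup

theorem coe_mul_sub_mem {g g' h h' : 𝔞.GroupLike} {i : ℕ} (hg : g.1 - g'.1 ∈ 𝔞.F i 0)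
    (hh : h.1 - h'.1 ∈ 𝔞.F i 0) : (g * h).1 - (g' * h').1 ∈ 𝔞.F i 0 :=
  circOneAdd_sub_mem h.2 h'.2 hg (by simpa using hh)

theorem coe_inv_sub_mem {g g' : 𝔞.GroupLike} {i : ℕ} (hg : g.1 - g'.1 ∈ 𝔞.F i 0) :
    (g⁻¹).1 - (g'⁻¹).1 ∈ 𝔞.F i 0 := by
  -- Multiplying `g ≡ g'` by `g⁻¹` on the left and by `g'⁻¹` on the right gives `g'⁻¹ ≡ g⁻¹`, from
  -- the congruence for products alone.
  have h1 : (g⁻¹ * g).1 - (g⁻¹ * g').1 ∈ 𝔞.F i 0 := coe_mul_sub_mem (by simp) hg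
  have h2 := coe_mul_sub_mem (h := g'⁻¹) (h' := g'⁻¹) h1 (by simp)
  simpa using sub_mem_symm h2

theorem isTopologicalGroup : IsTopologicalGroup 𝔞.GroupLike where
  continuous_mul := by
    rw [continuous_groupLike_iff]
    refine fun y i => isOpen_prod_iff.2 fun g h hgh => ?_
    refine ⟨_, _, isOpen_groupLike_ball g i, isOpen_groupLike_ball h i, mem_groupLike_ball g i,
      mem_groupLike_ball h i, ?_⟩
    exact fun p hp => sub_mem_trans (coe_mul_sub_mem hp.1 hp.2) hgh
  continuous_inv := by
    rw [continuous_groupLike_iff]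
    refine fun y i => isOpen_iff_forall_mem_open.2 fun g hg => ?_
    exact ⟨_, fun p hp => sub_mem_trans (coe_inv_sub_mem hp) hg, isOpen_groupLike_ball g i,
      mem_groupLike_ball g i⟩

/-- The gauge action on the set of Maurer–Cartan elements. -/
@[reducible] noncomputable def gaugeAction : MulAction 𝔞.GroupLike 𝔞.MC where
  smul g a := ⟨𝔞.gaugeTransform (log g) a.1, gaugeTransform_maurerCartan (log_mem g) a.2⟩
  one_smul a := Subtype.ext (by
    have : log (1 : 𝔞.GroupLike) = 0 := log_eq (zero_mem _) (by
      rw [exp, expSubOne_zero, add_zero, coe_one])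
    change 𝔞.gaugeTransform (log (1 : 𝔞.GroupLike)) a.1 = a.1
    rw [this, gaugeTransform_zero])
  mul_smul g h a := Subtype.ext (by
    refine (gaugeTransform_gaugeTransform a.1 (log_mem g) (log_mem h) (log_mem _) ?_).symm
    rw [expSubOne_log, expSubOne_log g, coe_mul, ← circ_sub_one (log_mem h), exp_log])

attribute [local instance] gaugeAction

theorem coe_smul (g : 𝔞.GroupLike) (a : 𝔞.MC) : (g • a).1 = 𝔞.gaugeTransform (log g) a.1 := rfl

theorem coe_smul_sub_mem {g g' : 𝔞.GroupLike} {a a' : 𝔞.MC} {i : ℕ}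
    (hg : g.1 - g'.1 ∈ 𝔞.F i 0) (ha : a.1 - a'.1 ∈ 𝔞.F i (-1)) :
    (g • a).1 - (g' • a').1 ∈ 𝔞.F i (-1) := by
  refine gaugeTransform_sub_mem (log_mem g) (log_mem g') ?_ ?_ ha
  · simpa [expSubOne_log] using hg
  · rw [← exp_sub_one, ← exp_sub_one, sub_sub_sub_cancel_right]
    exact coe_inv_sub_mem hg

theorem continuousSMul : ContinuousSMul 𝔞.GroupLike 𝔞.MC where
  continuous_smul := by
    rw [continuous_mc_iff]
    refine fun y i => isOpen_prod_iff.2 fun g a hga => ?_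
    refine ⟨_, _, isOpen_groupLike_ball g i, isOpen_mc_ball a i, mem_groupLike_ball g i,
      mem_mc_ball a i, ?_⟩
    exact fun p hp => sub_mem_trans (coe_smul_sub_mem hp.1 hp.2) hga

theorem expAd_eq_circ {m : ℤ} (x : A m) {l : A 0} (hl : l ∈ 𝔞.F 1 0) :
    𝔞.expAd l x = 𝔞.circ (𝔞.star (zero_add m) (𝔞.exp l) x) (𝔞.exp (-l)) := by
  rw [expAd_eq_circOneAdd _ hl, circ, exp_sub_one, exp, map_add, LinearMap.add_apply,
    𝔞.one_star, oneAddStar]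

end GaugeGroup

end CompleteLeftUnitalDGPreLie

theorem mainTheorem3 {k : Type u} [CommRing k] [Algebra ℚ k] {A : ℤ → Type v}
    [∀ n, AddCommGroup (A n)] [∀ n, Module k (A n)] (𝔞 : CompleteLeftUnitalDGPreLie k A) :
    -- the pre-Lie exponential is a bijection from `F_1 A_0` to `1 + F_1 A_0`
    Set.BijOn 𝔞.exp {l | l ∈ 𝔞.F 1 0} {g | g - 𝔞.one ∈ 𝔞.F 1 0} ∧
    -- the gauge group and its action
    ∃ (_ : Group 𝔞.GroupLike) (_ : MulAction 𝔞.GroupLike 𝔞.MC),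
      (∀ g h : 𝔞.GroupLike, (g * h).1 = 𝔞.circ g.1 h.1) ∧
      (1 : 𝔞.GroupLike).1 = 𝔞.one ∧
      IsTopologicalGroup 𝔞.GroupLike ∧
      ContinuousSMul 𝔞.GroupLike 𝔞.MC ∧
      ∀ (l : A 0) (g : 𝔞.GroupLike) (a : 𝔞.MC), l ∈ 𝔞.F 1 0 → g.1 = 𝔞.exp l →
        -- the formulas in the extension `A ⊕ k δ`
        (CompleteDGPreLie.delta k A + CompleteDGPreLie.incl k (g • a).1
            = 𝔞.extension.expAd (CompleteDGPreLie.incl k l)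
                (CompleteDGPreLie.delta k A + CompleteDGPreLie.incl k a.1) ∧
          CompleteDGPreLie.delta k A + CompleteDGPreLie.incl k (g • a).1
            = 𝔞.extension.circOneAdd
                (𝔞.extension.oneAddStar (CompleteDGPreLie.incl k (𝔞.exp l - 𝔞.one))
                  (CompleteDGPreLie.delta k A + CompleteDGPreLie.incl k a.1))
                (CompleteDGPreLie.incl k (𝔞.exp (-l) - 𝔞.one))) ∧
        -- the formulas in `A` itself, when the differential is internal to it
        (∀ δ : A (-1),
          (∀ {p q : ℤ} (h : q + 1 = p) (x : A p),
            𝔞.d h x = 𝔞.bracket (show -1 + p = q by omega) δ x) →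
          δ + (g • a).1 = 𝔞.expAd l (δ + a.1) ∧
          δ + (g • a).1
            = 𝔞.circ (𝔞.star (zero_add (-1)) (𝔞.exp l) (δ + a.1)) (𝔞.exp (-l))) := by
  open CompleteDGPreLie CompleteLeftUnitalDGPreLie in
  refine ⟨exp_bijOn, gaugeGroup, gaugeAction, coe_mul, coe_one, isTopologicalGroup, continuousSMul,
    fun l g a hl hg => ?_⟩
  rw [coe_smul, log_eq hl hg, exp_sub_one, exp_sub_one]
  have h1 := delta_add_incl_gaugeTransform (𝔭 := 𝔞.toCompleteDGPreLie) hl a.1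
  refine ⟨⟨h1, delta_add_incl_gaugeTransform_eq_circOneAdd hl a.1⟩, fun δ hδ => ?_⟩
  have h2 : δ + 𝔞.gaugeTransform l a.1 = 𝔞.expAd l (δ + a.1) := by
    -- The formula in `A ⊕ k δ` is transported along the substitution of the internal element for
    -- the formal `δ`; the circle form then follows inside `A` itself.
    rw [← substDelta_delta_add_incl (k := k), h1, substDelta_expAd hl (hδ _ l),
      substDelta_delta_add_incl]
  exact ⟨h2, h2.trans (expAd_eq_circ _ hl)⟩
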